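/- **Setting.** Let $\mathbb T=\{|z|=1\}$, $\mathbb D_{\mathrm e}=\{|z|>1\}$, let $\mathrm{ds}$ be normalized arc length on $\mathbb T$, $\bar\partial=\tfrac12(\partial_x+\mathrm i\partial_y)$, $\varDelta=\tfrac14(\partial_x^2+\partial_y^2)$, and let $\zeta$ denote the coordinate function $\zeta(z)=z$. Let $\mathrm R$ be a real-valued function, real-analytic in a neighbourhood of $\mathbb T$, which vanishes on $\mathbb T$ together with its gradient, and with $\varDelta\mathrm R>0$ on $\mathbb T$. Let $\hat{\mathrm R}=\pm\sqrt{\mathrm R}$ near $\mathbb T$, with the sign $+$ for $|z|>1$ and $-$ for $|z|<1$. For a function $f$ on $\mathbb T$ and $z\in\mathbb D_{\mathrm e}$ put $$\mathbf H[f](z)=\int_{\mathbb T}\frac{z+\zeta}{z-\zeta}f(\zeta)\,\mathrm{ds}(\zeta),\quad \mathbf P[f](z)=z\int_{\mathbb T}\frac{f(\zeta)}{z-\zeta}\,\mathrm{ds}(\zeta),\quad \mathbf U[f](z)=(|z|^2-1)\int_{\mathbb T}\frac{f(\zeta)}{|z-\zeta|^2}\,\mathrm{ds}(\zeta).$$ These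 functions and those below are continued real-analytically across $\mathbb T$. Let $\mathrm H_{\mathrm R}=\pi^{-1/4}\exp\big(\tfrac14\mathbf H[\log\varDelta\mathrm R]\big)$, let $W_{\mathrm R}$ be the function near $\mathbb T$ with $\bar\partial\hat{\mathrm R}=(\pi/2)^{1/2}\zeta|\mathrm H_{\mathrm R}|^2+2W_{\mathrm R}\hat{\mathrm R}\,\bar\partial\hat{\mathrm R}$, and for $f$ real-analytic near $\mathbb T$ put $$\mathbf M[f]=\frac{f-\mathbf U[f]}{1-|\zeta|^2},\qquad \mathbf L[f]=\frac{(1-|\zeta|^2)\bar{\mathrm H}_{\mathrm R}}{4\hat{\mathrm R}\,\bar\partial\hat{\mathrm R}}\,\mathbf M[f]-(2\pi)^{-1/2}\frac{W_{\mathrm R}}{\zeta\mathrm H_{\mathrm R}}\,\mathbf P[f],\qquad \mathbf T[f]=\mathbf L\big[\bar\partial f/\bar{\mathrm H}_{\mathrm R}\big].$$ For $0<\sigma<1$ let $\rho(\sigma)=(\sigma+\sqrt{1+\sigma^2})^{-1}$ and $$\hat{\mathbb A}(\sigma)=\{(z,w)\in\mathbb C^2:\ \rho(\sigma)<|z|,|w|<\rho(\sigma)^{-1},\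 |z-w|<2\sigma\}.$$ Let $\mathscr H^\infty_\sigma$ be the space of bounded functions on $\hat{\mathbb A}(\sigma)$ that are holomorphic in $(z,\bar w)$, with the supremum norm $\|\cdot\|_{\mathscr H^\infty_\sigma}$ (this norm is used, possibly with value $+\infty$, for every function on $\hat{\mathbb A}(\sigma)$). A function $f$ near $\mathbb T$ is regarded as an element of $\mathscr H^\infty_\sigma$ if there is $f^\diamond\in\mathscr H^\infty_\sigma$ with $f^\diamond(z,z)=f(z)$ for $z$ near $\mathbb T$; its polarization $f^\diamond$ is then unique. **Theorem.** Suppose that $0<\sigma_0<1$ is such that $$\frac1{\bar{\mathrm H}_{\mathrm R}},\qquad \bar{\mathrm H}_{\mathrm R}\frac{1-|\zeta|^2}{4\hat{\mathrm R}\,\bar\partial\hat{\mathrm R}},\qquad \frac{W_{\mathrm R}}{\zeta\mathrm H_{\mathrm R}}$$ are elements of $\mathscr H^\infty_{\sigma_0}$. Then there is a constant $M_1>0$, depending only on $\mathrm R$ and $\sigma_0$, such that for every $f\in\mathscr H^\infty_{\sigma_0}$ the following hold. For every integer $k\ge0$ (with $k^{2k}=1$ for $k=0$), $\mathbf T^k[f]\in\mathscr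 H^\infty_{\sigma_0/2}$ and $$\|(\mathbf T^k[f])^\diamond\|_{\mathscr H^\infty_{\sigma_0/2}}\le M_1^k\,k^{2k}\,\|f^\diamond\|_{\mathscr H^\infty_{\sigma_0}}.$$ For every integer $k\ge2$, $$\|\bar\partial_w(\mathbf T^{k-1}[f])^\diamond\|_{\mathscr H^\infty_{\sigma_0/2}}\le 6\,M_1^{k-1}k^{2k-1}\,\|f^\diamond\|_{\mathscr H^\infty_{\sigma_0}},$$ while for $k=1$ $$\|\bar\partial_w f^\diamond\|_{\mathscr H^\infty_{\sigma_0/2}}\le \frac{12}{\sigma_0}\,\|f^\diamond\|_{\mathscr H^\infty_{\sigma_0}}.$$ -/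

import Mathlib

open scoped Topology ENNReal NNReal ComplexConjugate

noncomputable section

namespace SoftRH

/-- The unit circle `𝕋`. -/
def unitCircle : Set ℂ := Metric.sphere 0 1

/-- The Wirtinger derivative `∂̄ f = (∂ₓ f + i ∂ᵧ f) / 2`. -/
def dbar (f : ℂ → ℂ) (z : ℂ) : ℂ :=
  (1 / 2) * (fderiv ℝ f z 1 + Complex.I * fderiv ℝ f z Complex.I)

/-- The normalized Laplacian `∂ ∂̄ = (∂ₓ² + ∂ᵧ²) / 4`. -/
def quarterLaplacian (u : ℂ → ℝ) (z : ℂ) : ℝ :=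
  (1 / 4) * Laplacian.laplacian u z

/-! ### Continuation across the unit circle -/

/-- `g` is real-analytic in a neighbourhood of the unit circle and coincides there, on the
exterior side, with `h`.  This determines the germ of `g` along the circle. -/
def ContinuesAcross (h g : ℂ → ℂ) : Prop :=
  AnalyticOnNhd ℝ g unitCircle ∧ ∀ᶠ z in 𝓝ˢ unitCircle, 1 < ‖z‖ → g z = h z

/-- The real-analytic function near the unit circle which on the exterior side is given by `h`
(an arbitrary function if `h` has no real-analytic continuation). -/
def acrossCircle (h : ℂ → ℂ) : ℂ → ℂ := Classical.epsilon (ContinuesAcross h)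

/-! ### Exterior transforms

`Real.circleAverage f 0 1` is the integral of `f` over the unit circle with respect to
normalized arc length. -/

/-- The exterior Herglotz transform, for `|z| > 1`. -/
def herglotzExt (f : ℂ → ℂ) (z : ℂ) : ℂ :=
  Real.circleAverage (fun ζ => (z + ζ) / (z - ζ) * f ζ) 0 1

/-- The exterior Szegő projection onto `H²₋`, for `|z| > 1`. -/
def szegoExt (f : ℂ → ℂ) (z : ℂ) : ℂ :=
  z * Real.circleAverage (fun ζ => f ζ / (z - ζ)) 0 1

/-- The Poisson integral in the exterior disk, for `|z| > 1`. -/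
def poissonExt (f : ℂ → ℂ) (z : ℂ) : ℂ :=
  ((‖z‖ ^ 2 - 1 : ℝ) : ℂ) * Real.circleAverage (fun ζ => f ζ / ((‖z - ζ‖ ^ 2 : ℝ) : ℂ)) 0 1

/-- The projection to `H²₋`, continued across the circle. -/
def projMinus (f : ℂ → ℂ) : ℂ → ℂ := acrossCircle (szegoExt f)

/-- The harmonic extension to the exterior disk, continued across the circle. -/
def harmExt (f : ℂ → ℂ) : ℂ → ℂ := acrossCircle (poissonExt f)

/-- The division operator `M[f] = (f - U[f]) / (1 - |ζ|²)`, continued across the circle. -/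
def opM (f : ℂ → ℂ) : ℂ → ℂ :=
  acrossCircle fun z => (f z - harmExt f z) / ((1 - ‖z‖ ^ 2 : ℝ) : ℂ)

/-! ### The functions built from `R` -/

/-- The signed square root of `R`, positive outside and negative inside the circle. -/
def hatR (R : ℂ → ℝ) (z : ℂ) : ℂ := ((SignType.sign (‖z‖ - 1) : ℝ) * Real.sqrt (R z) : ℝ)

/-- `H_R = π^(-1/4) exp (¼ 𝐇[log Δ R])`, continued across the circle. -/
def HR (R : ℂ → ℝ) : ℂ → ℂ :=
  acrossCircle fun z =>
    ((Real.pi ^ (-(1 / 4) : ℝ) : ℝ) : ℂ) *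
      Complex.exp ((1 / 4) * herglotzExt (fun ζ => (Real.log (quarterLaplacian R ζ) : ℂ)) z)

/-- `W_R`, which solves `∂̄ R̂ = (π/2)^(1/2) ζ |H_R|² + 2 W_R R̂ ∂̄ R̂` near the circle. -/
def WR (R : ℂ → ℝ) : ℂ → ℂ :=
  acrossCircle fun z =>
    (dbar (hatR R) z - (Real.sqrt (Real.pi / 2) : ℂ) * z * ((‖HR R z‖ ^ 2 : ℝ) : ℂ)) /
      (2 * hatR R z * dbar (hatR R) z)

/-- The coefficient `conj H_R`⁻¹. -/
def coefH (R : ℂ → ℝ) (z : ℂ) : ℂ := 1 / conj (HR R z)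

/-- The coefficient `conj H_R (1 - |ζ|²) / (4 R̂ ∂̄ R̂)`, continued across the circle. -/
def coefM (R : ℂ → ℝ) : ℂ → ℂ :=
  acrossCircle fun z =>
    conj (HR R z) * ((1 - ‖z‖ ^ 2 : ℝ) : ℂ) / (4 * hatR R z * dbar (hatR R) z)

/-- The coefficient `W_R / (ζ H_R)`. -/
def coefW (R : ℂ → ℝ) (z : ℂ) : ℂ := WR R z / (z * HR R z)

/-- The operator `L`. -/
def opL (R : ℂ → ℝ) (f : ℂ → ℂ) (z : ℂ) : ℂ :=
  coefM R z * opM f z -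
    ((Real.sqrt (2 * Real.pi))⁻¹ : ℂ) * coefW R z * projMinus f z

/-- The operator `T[f] = L[∂̄ f / conj H_R]`. -/
def opT (R : ℂ → ℝ) (f : ℂ → ℂ) : ℂ → ℂ :=
  opL R fun z => dbar f z / conj (HR R z)

/-! ### Polarization and the scale of Banach spaces -/

/-- The radius `ρ(σ)`. -/
def rho (σ : ℝ) : ℝ := 1 / (σ + Real.sqrt (1 + σ ^ 2))

/-- The annulus `ρ < |z| < 1/ρ`. -/
def annulus (ρ : ℝ) : Set ℂ := {z | ρ < ‖z‖ ∧ ‖z‖ < ρ⁻¹}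

/-- The polarized neighbourhood of the circle: pairs `(z, w)` of points of the annulus
of radius `ρ(σ)` with `|z - w| < 2σ`. -/
def polDomain (σ : ℝ) : Set (ℂ × ℂ) :=
  {p | p.1 ∈ annulus (rho σ) ∧ p.2 ∈ annulus (rho σ) ∧ ‖p.1 - p.2‖ < 2 * σ}

/-- The supremum norm over the polarized domain (possibly infinite). -/
def polNorm (σ : ℝ) (F : ℂ × ℂ → ℂ) : ℝ≥0∞ := ⨆ p ∈ polDomain σ, ‖F p‖ₑ

/-- `F` is a bounded function on the polarized domain, holomorphic in `(z, conj w)`, with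
`F (z, z) = f z` for `z` near the unit circle. -/
structure IsPolarization (σ : ℝ) (f : ℂ → ℂ) (F : ℂ × ℂ → ℂ) : Prop where
  holomorphic : DifferentiableOn ℂ (fun p : ℂ × ℂ => F (p.1, conj p.2))
    {p : ℂ × ℂ | (p.1, conj p.2) ∈ polDomain σ}
  bounded : polNorm σ F < ∞
  diagonal : ∀ᶠ z in 𝓝ˢ unitCircle, F (z, z) = f z

/-- The function `f`, given near the unit circle, is an element of `𝓗^∞_σ`. -/
def MemHInf (σ : ℝ) (f : ℂ → ℂ) : Prop := ∃ F, IsPolarization σ f F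

/-- The polarization of `f ∈ 𝓗^∞_σ`, which is unique on the (connected) polarized domain. -/
def polarize (σ : ℝ) (f : ℂ → ℂ) : ℂ × ℂ → ℂ := Classical.epsilon (IsPolarization σ f)

/-- The derivative with respect to `conj w` of a function of `(z, w)`. -/
def dbarW (F : ℂ × ℂ → ℂ) (p : ℂ × ℂ) : ℂ := dbar (fun w => F (p.1, w)) p.2

end SoftRH

end

/-! In the coordinates `(z, v)` with `v = conj w`, polarizations are holomorphic functions on
`holDomain σ`, and the theorem is a Cauchy–Kovalevskaya type estimate along this scale of domains:
for `σ' < σ ≤ σ₀`, `T` maps the space at level `σ` to the one at level `σ'` with norm at most `C /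
(σ - σ') ^ 2` (`exists_hasPol_opT`). Dividing the passage from `σ₀` to `σ₀ / 2` into `k` equal steps
bounds the `k`-th iterate by `(4 C k² / σ₀²) ^ k`.

One factor `1 / (σ - σ')` comes from `∂̄`, which acts on polarizations as `∂/∂v` and is controlled
by Cauchy's estimate. The other comes from `M` and `P`. The radius `ρ(σ)` is such that the curve `v
= 1/z` lies in the domain for every `z` in the annulus, so the values of `f` on the circle extend
holomorphically to the annulus as `K (z, 1/z)`. Then `P[f]` is the Laurent part of nonpositive
degree, and `U[f]` is that part plus the positive part evaluated at `1 / conj z`. The polarization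
of `f - U[f]` vanishes on `v = 1/z`, hence is divisible by `1 - z v`. The quotient is bounded by
splitting the numerator into a difference of `K` in its second slot (Schwarz lemma,
`norm_slice_sub_le`) and a difference of the positive Laurent part (`norm_laurentPlus_sub_le`), each
at most a constant times `|1 - z v| / (σ - σ')`.

Two uniqueness facts tie these formulas to the definitions made by choice: real-analytic
continuation across the circle is unique (`acrossCircle_eventuallyEq`), and so is the polarization
(`eq_zero_of_diag`). -/

noncomputable section

namespace SoftRH

open Metric Set Filter

/-! ### Joint analyticity of separately holomorphic functions -/

/-- A continuous family, indexed by a compact space, of holomorphic functions on a disc is an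
analytic function with values in the continuous functions on the index space. -/
theorem exists_analyticOnNhd_continuousMap {X : Type*} [TopologicalSpace X] [CompactSpace X]
    {f : ℂ → X → ℂ} {c : ℂ} {r : ℝ} (hr : 0 < r)
    (hf : ContinuousOn (Function.uncurry f) (sphere c r ×ˢ univ))
    (hd : ∀ x, DiffContOnCl ℂ (fun z => f z x) (ball c r)) :
    ∃ G : ℂ → C(X, ℂ), AnalyticOnNhd ℂ G (ball c r) ∧ ∀ z ∈ ball c r, ∀ x, G z x = f z x := by
  classical
  let q : C(sphere c r × X, ℂ) :=
    ⟨fun p => f p.1 p.2, hf.comp_continuous (f := fun p : sphere c r × X => ((p.1 : ℂ), p.2))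
      (by fun_prop) (fun p => ⟨p.1.2, mem_univ _⟩)⟩
  let h : ℂ → C(X, ℂ) := fun ζ => if hζ : ζ ∈ sphere c r then q.curry ⟨ζ, hζ⟩ else 0
  have hh : ∀ ζ ∈ sphere c r, ∀ x, h ζ x = f ζ x := by
    intro ζ hζ x
    simp only [h, dif_pos hζ]
    rfl
  have hcont : ContinuousOn h (sphere c r) := by
    rw [continuousOn_iff_continuous_domRestrict]
    have : (sphere c r).domRestrict h = q.curry := funext fun ζ => dif_pos ζ.2
    rw [this]
    exact q.curry.continuous
  have hint : CircleIntegrable h c r := hcont.circleIntegrable hr.le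
  lift r to ℝ≥0 using hr.le
  have hr' : 0 < r := by exact_mod_cast hr
  -- The Cauchy integral is taken in the Banach space `C(X, ℂ)`, which gives a power series there;
  -- evaluation at `x` commutes with the integral and recovers `f z x`.
  refine ⟨fun w => (2 * Real.pi * Complex.I : ℂ)⁻¹ • ∮ z in C(c, r), (z - w)⁻¹ • h z, ?_, ?_⟩
  · have := (hasFPowerSeriesOn_cauchy_integral hint hr').analyticOnNhd
    rwa [Metric.eball_coe] at this
  · intro z hz x
    have hk : ContinuousOn (fun ζ => (ζ - z)⁻¹ • h ζ) (sphere c r) := by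
      refine ContinuousOn.smul (ContinuousOn.inv₀ (f := fun ζ => ζ - z) (by fun_prop) ?_) hcont
      intro ζ hζ h0
      rw [sub_eq_zero.1 h0] at hζ
      exact (mem_ball.1 hz).ne (mem_sphere.1 hζ)
    have hi := hk.circleIntegrable hr.le
    rw [← (hd x).two_pi_i_inv_smul_circleIntegral_sub_inv_smul hz]
    have hev := (ContinuousMap.evalCLM ℂ x).intervalIntegral_comp_comm hi.out
    change ContinuousMap.evalCLM ℂ x
      ((2 * Real.pi * Complex.I : ℂ)⁻¹ • ∮ ζ in C(c, r), (ζ - z)⁻¹ • h ζ) = _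
    rw [map_smul]
    congr 1
    unfold circleIntegral
    rw [← hev]
    refine intervalIntegral.integral_congr fun θ _ => ?_
    simp only [map_smul]
    congr 2
    exact hh _ (circleMap_mem_sphere c hr.le θ) x

/-- Averaging over a circle, as a continuous functional. -/
theorem exists_circleAverage_clm (c : ℂ) {r : ℝ} (hr : 0 ≤ r) :
    ∃ Λ : C(sphere c r, ℂ) →L[ℂ] ℂ, ∀ (g : C(sphere c r, ℂ)) (f : ℂ → ℂ),
      (∀ ξ : sphere c r, g ξ = f ξ) → Λ g = Real.circleAverage f c r := by
  let p : ℝ → sphere c r := fun θ => ⟨circleMap c r θ, circleMap_mem_sphere c hr θ⟩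
  have hp : Continuous p := by
    apply Continuous.subtype_mk
    exact continuous_circleMap c r
  have hi : ∀ g : C(sphere c r, ℂ), IntervalIntegrable (fun θ => g (p θ)) MeasureTheory.volume
      0 (2 * Real.pi) := fun g => (g.continuous.comp hp).intervalIntegrable _ _
  let l : C(sphere c r, ℂ) →ₗ[ℂ] ℂ :=
    { toFun := fun g => (2 * Real.pi)⁻¹ • ∫ θ in (0 : ℝ)..2 * Real.pi, g (p θ)
      map_add' := by
        intro g g'
        simp only [ContinuousMap.add_apply]
        rw [intervalIntegral.integral_add (hi g) (hi g'), smul_add]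
      map_smul' := by
        intro a g
        simp only [ContinuousMap.smul_apply, RingHom.id_apply]
        rw [intervalIntegral.integral_smul, smul_comm] }
  refine ⟨l.mkContinuous 1 ?_, ?_⟩
  · intro g
    have := intervalIntegral.norm_integral_le_of_norm_le_const (a := 0) (b := 2 * Real.pi)
      (C := ‖g‖) (f := fun θ => g (p θ)) (fun θ _ => g.norm_coe_le_norm _)
    change ‖(2 * Real.pi)⁻¹ • ∫ θ in (0 : ℝ)..2 * Real.pi, g (p θ)‖ ≤ _
    rw [norm_smul, norm_inv, Real.norm_of_nonneg Real.two_pi_pos.le, one_mul,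
      inv_mul_le_iff₀ Real.two_pi_pos]
    rwa [sub_zero, abs_of_pos Real.two_pi_pos, mul_comm ‖g‖] at this
  · intro g f hgf
    change (2 * Real.pi)⁻¹ • ∫ θ in (0 : ℝ)..2 * Real.pi, g (p θ) = _
    unfold Real.circleAverage
    congr 1
    exact intervalIntegral.integral_congr fun θ _ => hgf (p θ)

/-- A function on a bidisc which is continuous on the product of the closed first disc and the
second circle, and separately holomorphic, is jointly analytic. -/
theorem analyticOnNhd_bidisc {F : ℂ × ℂ → ℂ} {a c : ℂ} {r s : ℝ} (hr : 0 < r) (hs : 0 < s)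
    (hF : ContinuousOn F (sphere a r ×ˢ sphere c s))
    (h1 : ∀ ξ ∈ sphere c s, DiffContOnCl ℂ (fun z => F (z, ξ)) (ball a r))
    (h2 : ∀ z ∈ ball a r, DiffContOnCl ℂ (fun ξ => F (z, ξ)) (ball c s)) :
    AnalyticOnNhd ℂ F (ball a r ×ˢ ball c s) := by
  obtain ⟨G, hG, hGF⟩ := exists_analyticOnNhd_continuousMap (X := sphere c s)
    (f := fun z ξ => F (z, ξ)) hr
    (hF.comp (by fun_prop) (fun p hp => ⟨hp.1, p.2.2⟩)) (fun ξ => h1 ξ ξ.2)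
  obtain ⟨Λ, hΛ⟩ := exists_circleAverage_clm c hs.le
  let ι : C(sphere c s, ℂ) := ⟨fun ξ => ξ, continuous_subtype_val⟩
  let one : C(sphere c s, ℂ) := 1
  have hker : ∀ w ∈ ball c s, IsUnit (ι - w • one) := by
    intro w hw
    rw [ContinuousMap.isUnit_iff_forall_ne_zero]
    intro ξ h0
    have : (ξ : ℂ) = w := by simpa [ι, one, sub_eq_zero] using h0
    exact (mem_ball.1 hw).ne (this ▸ mem_sphere.1 ξ.2)
  have hval : ∀ w ∈ ball c s, ∀ ξ : sphere c s, Ring.inverse (ι - w • one) ξ = ((ξ : ℂ) - w)⁻¹ := by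
    intro w hw ξ
    have h := Ring.mul_inverse_cancel _ (hker w hw)
    have h' := DFunLike.congr_fun h ξ
    refine eq_inv_of_mul_eq_one_right ?_
    simpa [ι, one] using h'
  have hinv : ∀ w ∈ ball c s, AnalyticAt ℂ (fun w : ℂ => Ring.inverse (ι - w • one)) w := by
    intro w hw
    obtain ⟨u, hu⟩ := hker w hw
    have h := analyticAt_inverse (𝕜 := ℂ) u
    rw [hu] at h
    refine h.comp_of_eq (f := fun w : ℂ => ι - w • one) ?_ rfl
    exact analyticAt_const.sub (analyticAt_id.smul analyticAt_const)
  -- Cauchy's formula in the second variable, with the kernel written as an inverse in the Banach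
  -- algebra `C(sphere c s, ℂ)`. Inversion is analytic there, so the right side is visibly jointly
  -- analytic in both variables.
  have key : ∀ p ∈ ball a r ×ˢ ball c s,
      F p = Λ (G p.1 * ((ι - c • one) * Ring.inverse (ι - p.2 • one))) := by
    rintro ⟨z, w⟩ ⟨hz, hw⟩
    rw [hΛ _ (fun ξ => ((ξ - c) / (ξ - w)) • F (z, ξ))]
    · have hs' : |s| = s := abs_of_pos hs
      exact (DiffContOnCl.circleAverage_smul_div (by rw [hs']; exact h2 z hz)
        (by rwa [hs'])).symm
    · intro ξ
      have e1 : G z ξ = F (z, ξ) := hGF z hz ξ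
      simp only [ContinuousMap.mul_apply, e1, hval w hw ξ, smul_eq_mul, div_eq_mul_inv]
      simp [ι, one, mul_comm]
  intro p hp
  have hopen : IsOpen (ball a r ×ˢ ball c s) := isOpen_ball.prod isOpen_ball
  refine AnalyticAt.congr ?_ (Filter.eventuallyEq_of_mem (hopen.mem_nhds hp) key).symm
  refine (Λ.analyticAt _).comp ?_
  refine ((hG _ hp.1).comp analyticAt_fst).mul (analyticAt_const.mul ?_)
  exact (hinv _ hp.2).comp analyticAt_snd

/-- Osgood's lemma in two variables: complex differentiable functions are analytic. -/
theorem analyticOnNhd_of_differentiableOn_prod {F : ℂ × ℂ → ℂ} {U : Set (ℂ × ℂ)} (hU : IsOpen U)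
    (hF : DifferentiableOn ℂ F U) : AnalyticOnNhd ℂ F U := by
  rintro ⟨a, c⟩ hp
  obtain ⟨r, hr, hrU⟩ := (Metric.nhds_basis_closedBall.mem_iff).1 (hU.mem_nhds hp)
  rw [← closedBall_prod_same] at hrU
  have hcl : closure (ball a r) ⊆ closedBall a r := closure_ball_subset_closedBall
  have hcl' : closure (ball c r) ⊆ closedBall c r := closure_ball_subset_closedBall
  refine analyticOnNhd_bidisc hr hr (hF.continuousOn.mono ?_) ?_ ?_ (a, c)
    ⟨mem_ball_self hr, mem_ball_self hr⟩
  · exact (Set.prod_mono sphere_subset_closedBall sphere_subset_closedBall).trans hrU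
  · intro ξ hξ
    apply DifferentiableOn.diffContOnCl
    exact hF.comp (by fun_prop) fun z hz => hrU ⟨hcl hz, sphere_subset_closedBall hξ⟩
  · intro z hz
    apply DifferentiableOn.diffContOnCl
    exact hF.comp (by fun_prop) fun ξ hξ => hrU ⟨ball_subset_closedBall hz, hcl' hξ⟩

/-! ### Geometry of the polarized domains -/

/-- The polarized domain in the coordinates `(z, conj w)`. -/
def holDomain (σ : ℝ) : Set (ℂ × ℂ) := {p | (p.1, conj p.2) ∈ polDomain σ}

theorem mem_holDomain {σ : ℝ} {p : ℂ × ℂ} : p ∈ holDomain σ ↔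
    p.1 ∈ annulus (rho σ) ∧ p.2 ∈ annulus (rho σ) ∧ ‖p.1 - conj p.2‖ < 2 * σ := by
  simp [holDomain, polDomain, annulus]

theorem isOpen_annulus (ρ : ℝ) : IsOpen (annulus ρ) :=
  (isOpen_lt continuous_const continuous_norm).inter (isOpen_lt continuous_norm continuous_const)

theorem isOpen_polDomain (σ : ℝ) : IsOpen (polDomain σ) :=
  ((isOpen_annulus _).preimage continuous_fst).inter
    (((isOpen_annulus _).preimage continuous_snd).inter
      (isOpen_lt (continuous_fst.sub continuous_snd).norm continuous_const))

theorem isOpen_holDomain (σ : ℝ) : IsOpen (holDomain σ) :=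
  (isOpen_polDomain σ).preimage
    (continuous_fst.prodMk (Complex.continuous_conj.comp continuous_snd))

theorem rho_pos (σ : ℝ) : 0 < rho σ := by
  have : |σ| < Real.sqrt (1 + σ ^ 2) := by
    rw [← Real.sqrt_sq_eq_abs]
    exact Real.sqrt_lt_sqrt (sq_nonneg _) (by linarith)
  exact one_div_pos.2 (by linarith [neg_abs_le σ])

theorem rho_inv (σ : ℝ) : (rho σ)⁻¹ = σ + Real.sqrt (1 + σ ^ 2) := by
  simp [rho]

theorem rho_eq (σ : ℝ) : rho σ = Real.sqrt (1 + σ ^ 2) - σ := by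
  have h := rho_pos σ
  have h1 : rho σ * (σ + Real.sqrt (1 + σ ^ 2)) = 1 := by
    rw [← rho_inv]; exact mul_inv_cancel₀ h.ne'
  have h2 : (Real.sqrt (1 + σ ^ 2) - σ) * (σ + Real.sqrt (1 + σ ^ 2)) = 1 := by
    have := Real.sq_sqrt (show 0 ≤ 1 + σ ^ 2 by positivity)
    linear_combination this
  have h3 : σ + Real.sqrt (1 + σ ^ 2) ≠ 0 := fun h0 => by simp [h0] at h1
  exact mul_right_cancel₀ h3 (h1.trans h2.symm)

theorem rho_lt_one {σ : ℝ} (hσ : 0 < σ) : rho σ < 1 := by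
  rw [rho_eq, sub_lt_iff_lt_add, Real.sqrt_lt' (by linarith)]
  nlinarith

theorem one_lt_rho_inv {σ : ℝ} (hσ : 0 < σ) : 1 < (rho σ)⁻¹ :=
  (one_lt_inv₀ (rho_pos σ)).2 (rho_lt_one hσ)

theorem rho_inv_sub (σ : ℝ) : (rho σ)⁻¹ - rho σ = 2 * σ := by
  rw [rho_inv, rho_eq]; ring

theorem rho_inv_sub_one_lt {σ : ℝ} (hσ : 0 < σ) : (rho σ)⁻¹ - 1 < 2 * σ := by
  have := rho_inv_sub σ
  have := rho_lt_one hσ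
  linarith

/-- With `s = √(1 + σ²)` and `t = √(1 + σ'²)`, `s - t = (σ² - σ'²) / (s + t) ≤ 5/6 (σ - σ')`,
because `σ ≤ 1` gives `s ≥ 6/5 σ` and likewise for `t`. What is left of `σ - σ'` is one sixth, the
source of every later `6`. -/
theorem rho_gap {σ' σ : ℝ} (h0 : 0 ≤ σ') (h : σ' ≤ σ) (h1 : σ ≤ 1) :
    rho σ + (σ - σ') / 6 ≤ rho σ' := by
  rw [rho_eq, rho_eq]
  have a := Real.sq_sqrt (show 0 ≤ 1 + σ ^ 2 by positivity)
  have b := Real.sq_sqrt (show 0 ≤ 1 + σ' ^ 2 by positivity)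
  set s := Real.sqrt (1 + σ ^ 2)
  set t := Real.sqrt (1 + σ' ^ 2)
  have hs : 6 / 5 * σ ≤ s := Real.le_sqrt_of_sq_le (by nlinarith)
  have ht : 6 / 5 * σ' ≤ t := Real.le_sqrt_of_sq_le (by nlinarith)
  have hs0 : 1 ≤ s := Real.one_le_sqrt.2 (by nlinarith)
  have ht0 : 1 ≤ t := Real.one_le_sqrt.2 (by nlinarith)
  by_contra! hlt
  have : 5 / 6 * (σ - σ') < s - t := by linarith
  nlinarith [mul_lt_mul_of_pos_right this (show 0 < s + t by linarith),
    mul_le_mul_of_nonneg_left (show 6 / 5 * (σ + σ') ≤ s + t by linarith)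
      (show 0 ≤ σ - σ' by linarith)]

theorem rho_inv_gap {σ' σ : ℝ} (h0 : 0 ≤ σ') (h : σ' ≤ σ) :
    (rho σ')⁻¹ + (σ - σ') ≤ (rho σ)⁻¹ := by
  rw [rho_inv, rho_inv]
  have : Real.sqrt (1 + σ' ^ 2) ≤ Real.sqrt (1 + σ ^ 2) := Real.sqrt_le_sqrt (by nlinarith)
  linarith

theorem rho_inv_le {σ : ℝ} (h1 : σ ≤ 1) (h0 : 0 ≤ σ) : (rho σ)⁻¹ ≤ 5 / 2 := by
  rw [rho_inv]
  have : Real.sqrt (1 + σ ^ 2) ≤ 3 / 2 := Real.sqrt_le_iff.2 ⟨by norm_num, by nlinarith⟩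
  linarith

theorem le_rho {σ : ℝ} (h1 : σ ≤ 1) (h0 : 0 ≤ σ) : 2 / 5 ≤ rho σ := by
  have := inv_anti₀ (inv_pos.2 (rho_pos σ)) (rho_inv_le h1 h0)
  rw [inv_inv] at this
  linarith

theorem annulus_mono {ρ ρ' : ℝ} (h0 : 0 < ρ) (h : ρ ≤ ρ') : annulus ρ' ⊆ annulus ρ :=
  fun _ hz => ⟨h.trans_lt hz.1, hz.2.trans_le (inv_anti₀ h0 h)⟩

theorem ne_zero_of_mem_annulus {ρ : ℝ} (h0 : 0 < ρ) {z : ℂ} (hz : z ∈ annulus ρ) : z ≠ 0 :=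
  norm_pos_iff.1 (h0.trans hz.1)

theorem inv_mem_annulus {ρ : ℝ} (h0 : 0 < ρ) {z : ℂ} (hz : z ∈ annulus ρ) : z⁻¹ ∈ annulus ρ := by
  have hz0 : 0 < ‖z‖ := h0.trans hz.1
  refine ⟨?_, ?_⟩
  · rw [norm_inv]
    exact (lt_inv_comm₀ h0 hz0).2 hz.2
  · rw [norm_inv]
    exact (inv_lt_inv₀ hz0 h0).2 hz.1

theorem unitCircle_subset_annulus {σ : ℝ} (hσ : 0 < σ) : unitCircle ⊆ annulus (rho σ) := by
  intro z hz
  have hz : ‖z‖ = 1 := by simpa [unitCircle] using hz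
  simp only [annulus, mem_ofPred_eq, hz]
  exact ⟨rho_lt_one hσ, one_lt_rho_inv hσ⟩

/-- The anti-diagonal of the bi-annulus is contained in the polarized domain. -/
theorem mk_inv_mem_holDomain {σ : ℝ} {z : ℂ} (hz : z ∈ annulus (rho σ)) :
    (z, z⁻¹) ∈ holDomain σ := by
  have h0 := rho_pos σ
  refine mem_holDomain.2 ⟨hz, inv_mem_annulus h0 hz, ?_⟩
  have hz0 : 0 < ‖z‖ := h0.trans hz.1
  -- The points `z` and `1 / conj z` lie on one ray, so their distance is `| |z| - 1/|z| |`, which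
  -- is below `1/ρ - ρ = 2σ`.
  have hc : z - conj z⁻¹ = ((‖z‖ - ‖z‖⁻¹ : ℝ) : ℂ) * (z / ‖z‖) := by
    have h1 : z * conj z = (‖z‖ : ℂ) ^ 2 := Complex.mul_conj' z
    have h2 : (‖z‖ : ℂ) ≠ 0 := by exact_mod_cast hz0.ne'
    have h3 : conj z ≠ 0 := by
      intro h; rw [h, mul_zero] at h1
      exact pow_ne_zero 2 h2 h1.symm
    rw [map_inv₀]
    push_cast
    field_simp
    linear_combination h1
  dsimp only
  rw [hc, norm_mul, norm_div, Complex.norm_real, Complex.norm_real, norm_norm,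
    div_self hz0.ne', mul_one, Real.norm_eq_abs, abs_lt, ← rho_inv_sub]
  have h3 : ‖z‖⁻¹ < (rho σ)⁻¹ := (inv_lt_inv₀ hz0 h0).2 hz.1
  have h4 : rho σ < ‖z‖⁻¹ := (lt_inv_comm₀ h0 hz0).2 hz.2
  constructor <;> linarith [hz.1, hz.2]

theorem mk_conj_mem_holDomain {σ : ℝ} (hσ : 0 < σ) {z : ℂ} (hz : z ∈ unitCircle) :
    (z, conj z) ∈ holDomain σ := by
  refine mem_holDomain.2 ⟨unitCircle_subset_annulus hσ hz, ?_, by simpa using hσ⟩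
  have := unitCircle_subset_annulus hσ hz
  simpa [annulus] using this

/-- Room for Cauchy estimates in the second variable. The inner radius is the tightest constraint:
the outer radius has slack `σ - σ'` and the condition on `z - w` has slack `2(σ - σ')`. -/
theorem holDomain_ball {σ' σ : ℝ} (h0 : 0 ≤ σ') (h : σ' ≤ σ) (h1 : σ ≤ 1) {p : ℂ × ℂ}
    (hp : p ∈ holDomain σ') {v : ℂ} (hv : ‖v - p.2‖ ≤ (σ - σ') / 6) : (p.1, v) ∈ holDomain σ := by
  obtain ⟨ha, hb, hc⟩ := mem_holDomain.1 hp
  have g1 := rho_gap h0 h h1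
  have g2 := rho_inv_gap h0 h
  have hρ := rho_pos σ
  refine mem_holDomain.2 ⟨annulus_mono hρ (by linarith) ha, ⟨?_, ?_⟩, ?_⟩
  · have : ‖p.2‖ ≤ ‖v‖ + ‖v - p.2‖ := by
      have := norm_sub_le v (v - p.2)
      simpa using this
    have := hb.1
    dsimp only
    linarith
  · have : ‖v‖ ≤ ‖p.2‖ + ‖v - p.2‖ := by
      have := norm_add_le p.2 (v - p.2)
      simpa using this
    have := hb.2
    dsimp only
    linarith
  · have e : p.1 - conj v = (p.1 - conj p.2) - conj (v - p.2) := by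
      rw [map_sub]; ring
    have := norm_sub_le (p.1 - conj p.2) (conj (v - p.2))
    rw [← e, Complex.norm_conj] at this
    dsimp only
    linarith

theorem holDomain_mono {σ' σ : ℝ} (h0 : 0 ≤ σ') (h : σ' ≤ σ) (h1 : σ ≤ 1) :
    holDomain σ' ⊆ holDomain σ := fun p hp => by
  simpa using holDomain_ball h0 h h1 hp (v := p.2)
    (by rw [sub_self, norm_zero]; linarith)

/-! ### Continuation across the circle -/

/-- A real-analytic continuation across the circle is unique near the circle. -/
theorem acrossCircle_eventuallyEq {h g : ℂ → ℂ} (hg : ContinuesAcross h g) :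
    acrossCircle h =ᶠ[𝓝ˢ unitCircle] g := by
  have ha : ContinuesAcross h (acrossCircle h) := Classical.epsilon_spec ⟨g, hg⟩
  refine eventually_nhdsSet_iff_forall.2 fun a hau => ?_
  have han := ((ha.1 a hau).sub (hg.1 a hau)).eventually_analyticAt
  have heq : ∀ᶠ z in 𝓝 a, 1 < ‖z‖ → acrossCircle h z - g z = 0 := by
    filter_upwards [eventually_nhdsSet_iff_forall.1 ha.2 a hau,
      eventually_nhdsSet_iff_forall.1 hg.2 a hau] with z h1 h2 hz
    rw [h1 hz, h2 hz, sub_self]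
  obtain ⟨r, hr, hball⟩ := Metric.eventually_nhds_iff_ball.1 (han.and heq)
  have ha1 : ‖a‖ = 1 := by simpa [unitCircle] using hau
  -- A point of the ball strictly outside the circle: both continuations agree near it, and the
  -- identity theorem carries the agreement to the whole ball.
  have hb : ((1 + r / 2 : ℝ) : ℂ) * a ∈ ball a r := by
    rw [mem_ball_iff_norm]
    have : ((1 + r / 2 : ℝ) : ℂ) * a - a = ((r / 2 : ℝ) : ℂ) * a := by push_cast; ring
    rw [this, norm_mul, ha1, Complex.norm_real, Real.norm_of_nonneg (by linarith)]
    linarith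
  have hb1 : 1 < ‖((1 + r / 2 : ℝ) : ℂ) * a‖ := by
    rw [norm_mul, ha1, Complex.norm_real, Real.norm_of_nonneg (by linarith)]
    linarith
  have hev : (fun z => acrossCircle h z - g z) =ᶠ[𝓝 (((1 + r / 2 : ℝ) : ℂ) * a)] 0 := by
    filter_upwards [isOpen_ball.mem_nhds hb, (isOpen_lt continuous_const continuous_norm).mem_nhds
      hb1] with z hz hz1
    exact (hball z hz).2 hz1
  have hzero := AnalyticOnNhd.eqOn_zero_of_preconnected_of_eventuallyEq_zero
    (fun z hz => (hball z hz).1) (convex_ball a r).isPreconnected hb hev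
  filter_upwards [ball_mem_nhds a hr] with z hz
  exact sub_eq_zero.1 (hzero hz)

/-! ### Polarizations with bounds -/

/-- `K` is holomorphic on the polarized domain, bounded there by `B`, and restricts to `f` on the
diagonal near the circle. -/
structure HasPol (σ : ℝ) (f : ℂ → ℂ) (K : ℂ × ℂ → ℂ) (B : ℝ) : Prop where
  diff : DifferentiableOn ℂ K (holDomain σ)
  bound : ∀ p ∈ holDomain σ, ‖K p‖ ≤ B
  diag : ∀ᶠ z in 𝓝ˢ unitCircle, K (z, conj z) = f z

namespace HasPol

variable {σ σ' : ℝ} {f g : ℂ → ℂ} {K L : ℂ × ℂ → ℂ} {B C : ℝ}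

theorem mono (h : HasPol σ f K B) (h0 : 0 ≤ σ') (hσ : σ' ≤ σ) (h1 : σ ≤ 1) (hBC : B ≤ C) :
    HasPol σ' f K C :=
  ⟨h.diff.mono (holDomain_mono h0 hσ h1),
    fun p hp => (h.bound p (holDomain_mono h0 hσ h1 hp)).trans hBC, h.diag⟩

theorem nonneg (h : HasPol σ f K B) (hσ : 0 < σ) : 0 ≤ B :=
  (norm_nonneg _).trans (h.bound (1, conj 1) (mk_conj_mem_holDomain hσ (by simp [unitCircle])))

theorem mul (h : HasPol σ f K B) (h' : HasPol σ g L C) (hσ : 0 < σ) :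
    HasPol σ (fun z => f z * g z) (fun p => K p * L p) (B * C) := by
  refine ⟨h.diff.mul h'.diff, fun p hp => ?_, ?_⟩
  · rw [norm_mul]
    exact mul_le_mul (h.bound p hp) (h'.bound p hp) (norm_nonneg _) (h.nonneg hσ)
  · filter_upwards [h.diag, h'.diag] with z h1 h2
    rw [h1, h2]

theorem const_mul (h : HasPol σ f K B) (a : ℂ) :
    HasPol σ (fun z => a * f z) (fun p => a * K p) (‖a‖ * B) := by
  refine ⟨h.diff.const_mul a, fun p hp => ?_, ?_⟩
  · rw [norm_mul]
    exact mul_le_mul_of_nonneg_left (h.bound p hp) (norm_nonneg _)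
  · filter_upwards [h.diag] with z h1
    rw [h1]

theorem sub (h : HasPol σ f K B) (h' : HasPol σ g L C) :
    HasPol σ (fun z => f z - g z) (fun p => K p - L p) (B + C) := by
  refine ⟨h.diff.sub h'.diff, fun p hp => ?_, ?_⟩
  · exact (norm_sub_le _ _).trans (add_le_add (h.bound p hp) (h'.bound p hp))
  · filter_upwards [h.diag, h'.diag] with z h1 h2
    rw [h1, h2]

theorem analyticOnNhd (h : HasPol σ f K B) : AnalyticOnNhd ℂ K (holDomain σ) :=
  analyticOnNhd_of_differentiableOn_prod (isOpen_holDomain σ) h.diff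

theorem congr (h : HasPol σ f K B) (hfg : f =ᶠ[𝓝ˢ unitCircle] g) : HasPol σ g K B :=
  ⟨h.diff, h.bound, by filter_upwards [h.diag, hfg] with z h1 h2; rw [h1, h2]⟩

end HasPol

/-- The diagonal restriction of a polarization is real-analytic on the circle. -/
theorem analyticOnNhd_diag {σ : ℝ} (hσ : 0 < σ) {K : ℂ × ℂ → ℂ}
    (hK : DifferentiableOn ℂ K (holDomain σ)) :
    AnalyticOnNhd ℝ (fun z => K (z, conj z)) unitCircle := by
  intro z hz
  have h1 := (analyticOnNhd_of_differentiableOn_prod (isOpen_holDomain σ) hK _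
    (mk_conj_mem_holDomain hσ hz)).restrictScalars (𝕜 := ℝ)
  have h2 : AnalyticAt ℝ (fun z : ℂ => (z, conj z)) z :=
    AnalyticAt.prod analyticAt_id (Complex.conjCLE.toContinuousLinearMap.analyticAt z)
  exact h1.comp_of_eq h2 rfl

theorem eventually_mk_conj_mem_holDomain {σ : ℝ} (hσ : 0 < σ) :
    ∀ᶠ z in 𝓝ˢ unitCircle, (z, conj z) ∈ holDomain σ := by
  have hc : Continuous fun z : ℂ => (z, conj z) :=
    continuous_id.prodMk Complex.continuous_conj
  exact ((isOpen_holDomain σ).preimage hc).mem_nhdsSet.2 fun z hz => mk_conj_mem_holDomain hσ hz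

/-! ### The `∂̄`-derivative -/

/-- Chain rule: `∂̄` annihilates the holomorphic first slot and differentiates `conj z` to `1`,
leaving the partial derivative in the second variable. -/
theorem dbar_comp_mk_conj {K : ℂ × ℂ → ℂ} {z : ℂ} (hK : DifferentiableAt ℂ K (z, conj z)) :
    dbar (fun z => K (z, conj z)) z = fderiv ℂ K (z, conj z) (0, 1) := by
  have h1 := hK.hasFDerivAt.restrictScalars ℝ
  have h2 : HasFDerivAt (fun z : ℂ => (z, conj z))
      ((ContinuousLinearMap.id ℝ ℂ).prod Complex.conjCLE.toContinuousLinearMap) z :=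
    (hasFDerivAt_id z).prodMk Complex.conjCLE.toContinuousLinearMap.hasFDerivAt
  have h3 : HasFDerivAt (fun z => K (z, conj z)) _ z := h1.comp z h2
  unfold dbar
  rw [h3.fderiv]
  set D := fderiv ℂ K (z, conj z)
  have e1 : D ((1 : ℂ), (1 : ℂ)) = D (1, 0) + D (0, 1) := by rw [← map_add]; simp
  have e2 : D (Complex.I, -Complex.I) = Complex.I * D (1, 0) - Complex.I * D (0, 1) := by
    rw [← smul_eq_mul, ← smul_eq_mul, ← map_smul, ← map_smul, ← map_sub]; simp
  simp only [ContinuousLinearMap.comp_apply, ContinuousLinearMap.prod_apply,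
    ContinuousLinearMap.id_apply, ContinuousLinearEquiv.coe_coe, Complex.conjCLE_apply,
    Complex.conj_I, map_one, ContinuousLinearMap.coe_restrictScalars']
  rw [e1, e2]
  linear_combination (D (1, 0) - D (0, 1)) / 2 * Complex.I_sq

theorem dbar_comp_conj {k : ℂ → ℂ} {w : ℂ} (hk : DifferentiableAt ℂ k (conj w)) :
    dbar (fun w => k (conj w)) w = deriv k (conj w) := by
  have h : HasFDerivAt (fun p : ℂ × ℂ => k p.2) _ (w, conj w) :=
    hk.hasFDerivAt.comp (w, conj w) (hasFDerivAt_snd (𝕜 := ℂ) (p := (w, conj w)))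
  rw [dbar_comp_mk_conj (K := fun p => k p.2) h.differentiableAt, h.fderiv]
  simp

theorem dbar_eventuallyEq {f g : ℂ → ℂ} (h : f =ᶠ[𝓝ˢ unitCircle] g) :
    dbar f =ᶠ[𝓝ˢ unitCircle] dbar g := by
  refine eventually_nhdsSet_iff_forall.2 fun a ha => ?_
  filter_upwards [(eventually_nhdsSet_iff_forall.1 h a ha).eventually_nhds] with z hz
  unfold dbar
  rw [Filter.EventuallyEq.fderiv_eq hz]

theorem hasDerivAt_snd_slice {K : ℂ × ℂ → ℂ} {p : ℂ × ℂ} (hK : DifferentiableAt ℂ K p) :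
    HasDerivAt (fun v => K (p.1, v)) (fderiv ℂ K p (0, 1)) p.2 :=
  hK.hasFDerivAt.comp_hasDerivAt (f := fun v => (p.1, v)) p.2
    ((hasDerivAt_const p.2 p.1).prodMk (hasDerivAt_id p.2))

/-- Cauchy's estimate for the derivative in the second variable. -/
theorem norm_fderiv_snd_le {σ σ' B : ℝ} {K : ℂ × ℂ → ℂ} (h0 : 0 ≤ σ') (h : σ' < σ) (h1 : σ ≤ 1)
    (hK : DifferentiableOn ℂ K (holDomain σ)) (hB : ∀ p ∈ holDomain σ, ‖K p‖ ≤ B)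
    {p : ℂ × ℂ} (hp : p ∈ holDomain σ') :
    ‖fderiv ℂ K p (0, 1)‖ ≤ 6 / (σ - σ') * B := by
  have hpσ := holDomain_mono h0 h.le h1 hp
  have hr : 0 < (σ - σ') / 6 := by linarith
  rw [← (hasDerivAt_snd_slice (hK.differentiableAt ((isOpen_holDomain σ).mem_nhds hpσ))).deriv]
  have hball : ∀ v ∈ closedBall p.2 ((σ - σ') / 6), (p.1, v) ∈ holDomain σ := fun v hv =>
    holDomain_ball h0 h.le h1 hp (by simpa [dist_eq_norm] using hv)
  have := Complex.norm_deriv_le_of_forall_mem_sphere_norm_le (f := fun v => K (p.1, v)) (C := B) hr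
    (DifferentiableOn.diffContOnCl (hK.comp (by fun_prop)
      fun v hv => hball v (closure_ball_subset_closedBall hv)))
    (fun v hv => hB _ (hball v (sphere_subset_closedBall hv)))
  refine this.trans_eq ?_
  field_simp

theorem HasPol.dbar {σ σ' B : ℝ} {f : ℂ → ℂ} {K : ℂ × ℂ → ℂ} (hK : HasPol σ f K B)
    (h0 : 0 < σ') (h : σ' < σ) (h1 : σ ≤ 1) :
    HasPol σ' (dbar f) (fun p => fderiv ℂ K p (0, 1)) (6 / (σ - σ') * B) := by
  refine ⟨fun p hp => ?_, fun p hp => norm_fderiv_snd_le h0.le h h1 hK.diff hK.bound hp, ?_⟩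
  · have := (hK.analyticOnNhd p (holDomain_mono h0.le h.le h1 hp)).fderiv
    exact (this.differentiableAt.clm_apply (differentiableAt_const _)).differentiableWithinAt
  · have hd : (fun z => K (z, conj z)) =ᶠ[𝓝ˢ unitCircle] f := hK.diag
    filter_upwards [dbar_eventuallyEq hd, eventually_mk_conj_mem_holDomain (h0.trans h)]
      with z hz hz'
    rw [← hz, dbar_comp_mk_conj (hK.diff.differentiableAt ((isOpen_holDomain σ).mem_nhds hz'))]

/-! ### Uniqueness of polarizations -/

theorem frequently_eq_zero_of_real {g : ℂ → ℂ} {r : ℝ} (hr : 0 < r)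
    (hg : ∀ t : ℝ, |t| < r → g t = 0) : ∃ᶠ z in 𝓝[≠] (0 : ℂ), g z = 0 := by
  have h1 : Tendsto (fun t : ℝ => (t : ℂ)) (𝓝[≠] 0) (𝓝[≠] 0) := by
    refine tendsto_nhdsWithin_of_tendsto_nhds_of_eventually_within _ ?_ ?_
    · have := Complex.continuous_ofReal.tendsto 0
      rw [Complex.ofReal_zero] at this
      exact this.mono_left nhdsWithin_le_nhds
    · filter_upwards [self_mem_nhdsWithin] with t ht
      simpa using ht
  refine h1.frequently (Eventually.frequently ?_)
  filter_upwards [nhdsWithin_le_nhds (ball_mem_nhds (0 : ℝ) hr)] with t ht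
  exact hg t (by simpa using ht)

/-- A holomorphic function of two variables vanishing on the anti-holomorphic diagonal vanishes. -/
theorem eventually_eq_zero_of_conj_diag {D : ℂ × ℂ → ℂ} {a : ℂ} (hD : AnalyticAt ℂ D (a, conj a))
    (h0 : ∀ᶠ z in 𝓝 a, D (z, conj z) = 0) : ∀ᶠ p in 𝓝 (a, conj a), D p = 0 := by
  -- In the coordinates `z = a + (x + iy)`, `v = conj a + (x - iy)` the set `v = conj z` is `x, y`
  -- real. The one-variable identity theorem then applies first in `x`, next in `y`.
  let φ : ℂ × ℂ → ℂ × ℂ := fun p => (a + (p.1 + Complex.I * p.2), conj a + (p.1 - Complex.I * p.2))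
  have hφ : Continuous φ := by fun_prop
  have hφ0 : φ 0 = (a, conj a) := by simp [φ]
  have hφa : ∀ p, AnalyticAt ℂ φ p := fun p =>
    (analyticAt_const.add (analyticAt_fst.add (analyticAt_const.mul analyticAt_snd))).prod
      (analyticAt_const.add (analyticAt_fst.sub (analyticAt_const.mul analyticAt_snd)))
  have e1 : ∀ᶠ p in 𝓝 (0 : ℂ × ℂ), AnalyticAt ℂ D (φ p) := by
    have := hφ.tendsto 0
    rw [hφ0] at this
    exact this.eventually hD.eventually_analyticAt
  have e2 : ∀ᶠ p in 𝓝 (0 : ℂ × ℂ),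
      D (a + (p.1 + Complex.I * p.2), conj (a + (p.1 + Complex.I * p.2))) = 0 := by
    have : Tendsto (fun p : ℂ × ℂ => a + (p.1 + Complex.I * p.2)) (𝓝 0) (𝓝 a) := by
      have h : Continuous fun p : ℂ × ℂ => a + (p.1 + Complex.I * p.2) := by fun_prop
      simpa using h.tendsto 0
    exact this.eventually h0
  obtain ⟨r, hr, hball⟩ := Metric.eventually_nhds_iff_ball.1 (e1.and e2)
  have hmem : ∀ {x y : ℂ}, ‖x‖ < r → ‖y‖ < r → (x, y) ∈ ball (0 : ℂ × ℂ) r := by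
    intro x y hx hy
    rw [mem_ball_zero_iff, Prod.norm_def]
    exact max_lt hx hy
  have hE : ∀ x y : ℂ, ‖x‖ < r → ‖y‖ < r → AnalyticAt ℂ (fun p => D (φ p)) (x, y) :=
    fun x y hx hy => (hball _ (hmem hx hy)).1.comp (hφa _)
  have hE0 : ∀ x y : ℝ, |x| < r → |y| < r → D (φ (x, y)) = 0 := by
    intro x y hx hy
    have := (hball ((x : ℂ), (y : ℂ)) (hmem (by simpa using hx) (by simpa using hy))).2
    convert this using 2
    simp [φ, sub_eq_add_neg]
  have hE1 : ∀ (x : ℂ) (y : ℝ), ‖x‖ < r → |y| < r → D (φ (x, y)) = 0 := by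
    intro x y hx hy
    have han : AnalyticOnNhd ℂ (fun x : ℂ => D (φ (x, y))) (ball 0 r) := fun x hx =>
      AnalyticAt.comp (g := fun p => D (φ p)) (hE x y (by simpa using hx) (by simpa using hy))
        (analyticAt_id.prod analyticAt_const)
    exact han.eqOn_zero_of_preconnected_of_frequently_eq_zero (convex_ball _ _).isPreconnected
      (mem_ball_self hr) (frequently_eq_zero_of_real hr fun t ht => hE0 t y ht hy)
      (by simpa using hx)
  have hE2 : ∀ x y : ℂ, ‖x‖ < r → ‖y‖ < r → D (φ (x, y)) = 0 := by
    intro x y hx hy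
    have han : AnalyticOnNhd ℂ (fun y : ℂ => D (φ (x, y))) (ball 0 r) := fun y hy =>
      AnalyticAt.comp (g := fun p => D (φ p)) (hE x y hx (by simpa using hy))
        (analyticAt_const.prod analyticAt_id)
    exact han.eqOn_zero_of_preconnected_of_frequently_eq_zero (convex_ball _ _).isPreconnected
      (mem_ball_self hr) (frequently_eq_zero_of_real hr fun t ht => hE1 x t hx ht)
      (by simpa using hy)
  let ψ : ℂ × ℂ → ℂ × ℂ := fun p =>
    (((p.1 - a) + (p.2 - conj a)) / 2, -Complex.I * ((p.1 - a) - (p.2 - conj a)) / 2)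
  have hψ : Tendsto ψ (𝓝 (a, conj a)) (𝓝 0) := by
    have hc : Continuous ψ := by fun_prop
    have := hc.tendsto (a, conj a)
    have h0 : ψ (a, conj a) = 0 := by simp [ψ]
    rwa [h0] at this
  filter_upwards [hψ.eventually (Metric.ball_mem_nhds 0 hr)] with p hp
  rw [dist_zero_right, Prod.norm_def] at hp
  have hp' := hE2 _ _ (lt_of_le_of_lt (le_max_left _ _) hp) (lt_of_le_of_lt (le_max_right _ _) hp)
  have hinv : φ ((ψ p).1, (ψ p).2) = p := by
    refine Prod.ext ?_ ?_
    · simp only [φ, ψ]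
      linear_combination (-((p.1 - a) - (p.2 - conj a)) / 2) * Complex.I_sq
    · simp only [φ, ψ]
      linear_combination (((p.1 - a) - (p.2 - conj a)) / 2) * Complex.I_sq
  rwa [hinv] at hp'

theorem norm_mul_exp_sub_one_sq (s θ : ℝ) :
    ‖(s : ℂ) * Complex.exp (θ * Complex.I) - 1‖ ^ 2 = s ^ 2 + 1 - 2 * s * Real.cos θ := by
  rw [← Complex.normSq_eq_norm_sq, Complex.normSq_apply]
  simp only [Complex.sub_re, Complex.sub_im, Complex.re_ofReal_mul, Complex.im_ofReal_mul,
    Complex.exp_ofReal_mul_I_re, Complex.exp_ofReal_mul_I_im, Complex.one_re, Complex.one_im]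
  linear_combination s ^ 2 * Real.sin_sq_add_cos_sq θ

/-- The intersection of an annulus centred at `0` with a disc centred in the annulus is
connected. -/
theorem isPreconnected_annulus_inter_ball {ρ d : ℝ} (h0 : 0 < ρ) {m : ℂ} (hm : m ∈ annulus ρ) :
    IsPreconnected (annulus ρ ∩ ball m d) := by
  by_cases hd : 0 < d
  swap
  · rw [ball_eq_empty.2 (not_lt.1 hd), inter_empty]
    exact isPreconnected_empty
  refine isPreconnected_of_forall m ?_
  rintro z ⟨hz, hzd⟩
  have hm0 : m ≠ 0 := ne_zero_of_mem_annulus h0 hm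
  have hz0 : z ≠ 0 := ne_zero_of_mem_annulus h0 hz
  have hmn : 0 < ‖m‖ := norm_pos_iff.2 hm0
  have hzn : 0 < ‖z‖ := norm_pos_iff.2 hz0
  set s : ℝ := ‖z / m‖ with hs
  set θ : ℝ := Complex.arg (z / m) with hθ
  have hpolar : (s : ℂ) * Complex.exp (θ * Complex.I) = z / m := Complex.norm_mul_exp_arg_mul_I _
  have hs0 : 0 < s := norm_pos_iff.2 (div_ne_zero hz0 hm0)
  have hsm : ‖m‖ * s = ‖z‖ := by rw [hs, norm_div]; field_simp
  have hθπ : |θ| ≤ Real.pi := Complex.abs_arg_le_pi _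
  have hzm : z = m * (s * Complex.exp (θ * Complex.I)) := by rw [hpolar]; field_simp
  have hdist : ∀ x : ℂ, m * x ∈ ball m d ↔ ‖m‖ * ‖x - 1‖ < d := by
    intro x
    rw [mem_ball_iff_norm, ← norm_mul, mul_sub, mul_one]
  have hzd' : ‖m‖ * ‖(s : ℂ) * Complex.exp (θ * Complex.I) - 1‖ < d := by
    rw [← hdist, ← hzm]; exact hzd
  -- Rotating `z` at constant modulus towards the ray of `m` only decreases the distance to `m`,
  -- since the cosine of the angle grows. After that a radial segment leads to `m`; both pieces stay
  -- in the annulus and in the ball.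
  have hrot : ∀ t ∈ Icc (0 : ℝ) 1,
      ‖(s : ℂ) * Complex.exp ((t * θ : ℝ) * Complex.I) - 1‖ ≤
        ‖(s : ℂ) * Complex.exp (θ * Complex.I) - 1‖ := by
    intro t ht
    refine (sq_le_sq₀ (norm_nonneg _) (norm_nonneg _)).1 ?_
    rw [norm_mul_exp_sub_one_sq, norm_mul_exp_sub_one_sq]
    have : Real.cos θ ≤ Real.cos (t * θ) := by
      rw [← Real.cos_abs θ, ← Real.cos_abs (t * θ)]
      refine Real.cos_le_cos_of_nonneg_of_le_pi (abs_nonneg _) hθπ ?_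
      rw [abs_mul, abs_of_nonneg ht.1]
      exact mul_le_of_le_one_left (abs_nonneg _) ht.2
    nlinarith
  have hs1 : ‖m‖ * |s - 1| < d := by
    have := hrot 0 (by simp)
    simp only [zero_mul, Complex.ofReal_zero, Complex.exp_zero, mul_one] at this
    rw [← Complex.ofReal_one, ← Complex.ofReal_sub, Complex.norm_real, Real.norm_eq_abs] at this
    exact (mul_le_mul_of_nonneg_left this hmn.le).trans_lt hzd'
  refine ⟨(fun t : ℝ => m * (s * Complex.exp ((t * θ : ℝ) * Complex.I))) '' Icc 0 1 ∪
    (fun x : ℝ => m * (x : ℂ)) '' uIcc s 1, ?_, ?_, ?_, ?_⟩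
  · rintro _ (⟨t, ht, rfl⟩ | ⟨x, hx, rfl⟩)
    · refine ⟨?_, (hdist _).2 ?_⟩
      · have : ‖m * (s * Complex.exp ((t * θ : ℝ) * Complex.I))‖ = ‖z‖ := by
          rw [norm_mul, norm_mul, Complex.norm_exp_ofReal_mul_I, mul_one, Complex.norm_real,
            Real.norm_of_nonneg hs0.le, hsm]
        simpa only [annulus, mem_ofPred_eq, this] using hz
      · exact (mul_le_mul_of_nonneg_left (hrot t ht) hmn.le).trans_lt hzd'
    · have hx' : min s 1 ≤ x ∧ x ≤ max s 1 := hx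
      have hx0 : 0 < x := lt_of_lt_of_le (lt_min hs0 one_pos) hx'.1
      refine ⟨?_, (hdist _).2 ?_⟩
      · have : ‖m * (x : ℂ)‖ = ‖m‖ * x := by
          rw [norm_mul, Complex.norm_real, Real.norm_of_nonneg hx0.le]
        simp only [annulus, mem_ofPred_eq, this]
        constructor
        · rcases min_le_iff.1 hx'.1 with h | h
          · exact hz.1.trans_le (hsm ▸ mul_le_mul_of_nonneg_left h hmn.le)
          · exact hm.1.trans_le (le_mul_of_one_le_right hmn.le h)
        · rcases le_max_iff.1 hx'.2 with h | h
          · exact (hsm ▸ mul_le_mul_of_nonneg_left h hmn.le).trans_lt hz.2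
          · exact (mul_le_of_le_one_right hmn.le h).trans_lt hm.2
      · rw [← Complex.ofReal_one, ← Complex.ofReal_sub, Complex.norm_real, Real.norm_eq_abs]
        refine (mul_le_mul_of_nonneg_left ?_ hmn.le).trans_lt hs1
        have := abs_sub_right_of_mem_uIcc hx
        rwa [abs_sub_comm 1 x, abs_sub_comm 1 s] at this
  · exact Or.inr ⟨1, right_mem_uIcc, by simp⟩
  · exact Or.inl ⟨1, by simp, by simp only [one_mul]; exact hzm.symm⟩
  · refine IsPreconnected.union (m * s) ⟨0, by simp, by simp⟩ ⟨s, left_mem_uIcc, rfl⟩ ?_ ?_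
    · exact isPreconnected_Icc.image _ (by fun_prop)
    · exact isPreconnected_uIcc.image _ (by fun_prop)

/-- A holomorphic function on the polarized domain which vanishes on the diagonal near the circle
vanishes identically. -/
theorem eq_zero_of_diag {σ : ℝ} (hσ : 0 < σ) {D : ℂ × ℂ → ℂ}
    (hD : DifferentiableOn ℂ D (holDomain σ))
    (h0 : ∀ᶠ z in 𝓝ˢ unitCircle, D (z, conj z) = 0) {p : ℂ × ℂ} (hp : p ∈ holDomain σ) :
    D p = 0 := by
  have hρ := rho_pos σ
  have han := analyticOnNhd_of_differentiableOn_prod (isOpen_holDomain σ) hD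
  -- Vanishing near the diagonal spreads in `v` for each fixed `z` near the circle, as the `v`-slice
  -- is connected. Afterwards `v` is fixed and vanishing spreads in `z`.
  have hz_slice : ∀ a ∈ unitCircle, ∀ᶠ z in 𝓝 a, ∀ v, (z, v) ∈ holDomain σ → D (z, v) = 0 := by
    intro a ha
    have h1 := eventually_eq_zero_of_conj_diag (han _ (mk_conj_mem_holDomain hσ ha))
      (eventually_nhdsSet_iff_forall.1 h0 a ha)
    have hc : Tendsto (fun z : ℂ => (z, conj z)) (𝓝 a) (𝓝 (a, conj a)) :=
      (continuous_id.prodMk Complex.continuous_conj).tendsto a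
    filter_upwards [hc.eventually h1.eventually_nhds,
      (isOpen_annulus _).mem_nhds (unitCircle_subset_annulus hσ ha)] with z hz hza v hv
    have hslice : ∀ v, v ∈ (fun w : ℂ => conj w) '' (annulus (rho σ) ∩ ball z (2 * σ)) ↔
        (z, v) ∈ holDomain σ := by
      intro v
      rw [mem_holDomain]
      constructor
      · rintro ⟨w, ⟨hw, hwd⟩, rfl⟩
        refine ⟨hza, by simpa [annulus] using hw, ?_⟩
        simpa [dist_eq_norm, norm_sub_rev] using hwd
      · rintro ⟨-, h2, h3⟩
        refine ⟨conj v, ⟨by simpa [annulus] using h2, ?_⟩, by simp⟩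
        rw [mem_ball_iff_norm, norm_sub_rev]
        exact h3
    have hconn := (isPreconnected_annulus_inter_ball (d := 2 * σ) hρ hza).image
      (fun w : ℂ => conj w) Complex.continuous_conj.continuousOn
    have ha' : AnalyticOnNhd ℂ (fun v => D (z, v))
        ((fun w : ℂ => conj w) '' (annulus (rho σ) ∩ ball z (2 * σ))) := fun v hv =>
      (han _ ((hslice v).1 hv)).comp₂ analyticAt_const analyticAt_id
    refine ha'.eqOn_zero_of_preconnected_of_eventuallyEq_zero hconn (z₀ := conj z)
      ⟨z, ⟨hza, mem_ball_self (by linarith)⟩, rfl⟩ ?_ ((hslice v).2 hv)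
    have hc' : Tendsto (fun v : ℂ => (z, v)) (𝓝 (conj z)) (𝓝 (z, conj z)) :=
      (Continuous.prodMk_right z).tendsto _
    exact hc'.eventually hz
  obtain ⟨z₀, v₀⟩ := p
  obtain ⟨hz₀, hv₀, hd⟩ := mem_holDomain.1 hp
  have hv0 : 0 < ‖v₀‖ := hρ.trans hv₀.1
  have hcv : conj v₀ ∈ annulus (rho σ) := by simpa [annulus] using hv₀
  -- The radial projection of `conj v₀` to the circle: it lies in the `z`-slice over `v₀`, and `D`
  -- is already known to vanish near it.
  set a : ℂ := conj v₀ / ‖v₀‖ with ha_def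
  have ha : a ∈ unitCircle := by
    simp [unitCircle, ha_def, hv0.ne']
  have hslice : ∀ z, z ∈ annulus (rho σ) ∩ ball (conj v₀) (2 * σ) ↔ (z, v₀) ∈ holDomain σ := by
    intro z
    rw [mem_holDomain, mem_inter_iff, mem_ball_iff_norm]
    exact ⟨fun h => ⟨h.1, hv₀, h.2⟩, fun h => ⟨h.1, h.2.2⟩⟩
  have hav : (a, v₀) ∈ holDomain σ := by
    refine mem_holDomain.2 ⟨unitCircle_subset_annulus hσ ha, hv₀, ?_⟩
    have e : a - conj v₀ = a * ((1 - ‖v₀‖ : ℝ) : ℂ) := by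
      have : (‖v₀‖ : ℂ) ≠ 0 := by exact_mod_cast hv0.ne'
      rw [ha_def]; push_cast; field_simp
    have ha1 : ‖a‖ = 1 := by simpa [unitCircle] using ha
    dsimp only
    rw [e, norm_mul, ha1, one_mul, Complex.norm_real, Real.norm_eq_abs, abs_lt]
    have := rho_inv_sub_one_lt hσ
    have := rho_inv_sub σ
    have := one_lt_rho_inv hσ
    constructor <;> linarith [hv₀.1, hv₀.2]
  have ha' : AnalyticOnNhd ℂ (fun z => D (z, v₀)) (annulus (rho σ) ∩ ball (conj v₀) (2 * σ)) :=
    fun z hz => (han _ ((hslice z).1 hz)).comp₂ analyticAt_id analyticAt_const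
  refine ha'.eqOn_zero_of_preconnected_of_eventuallyEq_zero
    (isPreconnected_annulus_inter_ball hρ hcv) ((hslice a).2 hav) ?_ ((hslice z₀).2 hp)
  have hopen : ∀ᶠ z in 𝓝 a, (z, v₀) ∈ holDomain σ :=
    ((isOpen_holDomain σ).preimage (Continuous.prodMk_left v₀)).mem_nhds hav
  filter_upwards [hz_slice a ha, hopen] with z h1 h2
  exact h1 v₀ h2

/-! ### Laurent projections of holomorphic functions on an annulus -/

/-- The part of positive degree of the Laurent series, as a Cauchy integral over `|ζ| = R`. -/
def laurentPlus (φ : ℂ → ℂ) (R : ℝ) (u : ℂ) : ℂ :=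
  u * Real.circleAverage (fun ζ => φ ζ / (ζ - u)) 0 R

/-- The part of nonpositive degree of the Laurent series, as a Cauchy integral over `|ζ| = r`. -/
def laurentMinus (φ : ℂ → ℂ) (r : ℝ) (z : ℂ) : ℂ :=
  z * Real.circleAverage (fun ζ => φ ζ / (z - ζ)) 0 r

theorem circleAverage_const_mul (a : ℂ) (f : ℂ → ℂ) (r : ℝ) :
    Real.circleAverage (fun ζ => a * f ζ) 0 r = a * Real.circleAverage f 0 r :=
  Real.circleAverage_fun_smul (a := a)

theorem norm_circleAverage_le (f : ℂ → ℂ) (r : ℝ) :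
    ‖Real.circleAverage f 0 r‖ ≤ Real.circleAverage (fun ζ => ‖f ζ‖) 0 r := by
  unfold Real.circleAverage
  rw [norm_smul, norm_inv, Real.norm_of_nonneg Real.two_pi_pos.le, smul_eq_mul]
  exact mul_le_mul_of_nonneg_left
    (intervalIntegral.norm_integral_le_integral_norm Real.two_pi_pos.le)
    (inv_nonneg.2 Real.two_pi_pos.le)

/-- The average is `(2πi)⁻¹ ∮ ψ dζ/ζ`, so Cauchy's theorem on the annulus allows the radius to be
changed. -/
theorem circleAverage_eq_of_differentiable {ψ : ℂ → ℂ} {r₁ r₂ : ℝ} (h0 : 0 < r₁) (h : r₁ ≤ r₂)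
    (hψ : ∀ ζ, r₁ ≤ ‖ζ‖ → ‖ζ‖ ≤ r₂ → DifferentiableAt ℂ ψ ζ) :
    Real.circleAverage ψ 0 r₂ = Real.circleAverage ψ 0 r₁ := by
  rw [Real.circleAverage_eq_circleIntegral (h0.trans_le h).ne',
    Real.circleAverage_eq_circleIntegral h0.ne']
  congr 1
  refine Complex.circleIntegral_sub_center_inv_smul_eq_of_differentiable_on_annulus_off_countable
    h0 h countable_empty (fun ζ hζ => ?_) (fun ζ hζ => ?_)
  · have h1 : ‖ζ‖ ≤ r₂ ∧ r₁ ≤ ‖ζ‖ := by simpa using hζ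
    exact (hψ ζ h1.2 h1.1).continuousAt.continuousWithinAt
  · have h1 : ‖ζ‖ < r₂ ∧ r₁ < ‖ζ‖ := by simpa using hζ
    exact hψ ζ h1.2.le h1.1.le

theorem circleAverage_div_sub_eq_zero {z : ℂ} {R : ℝ} (hz : ‖z‖ < R) :
    Real.circleAverage (fun ζ => z / (ζ - z)) 0 R = 0 := by
  have hR : 0 < R := (norm_nonneg z).trans_lt hz
  have hne : ∀ ζ ∈ sphere (0 : ℂ) R, ζ - z ≠ 0 := by
    intro ζ hζ h
    rw [sub_eq_zero.1 h, mem_sphere_zero_iff_norm] at hζ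
    exact hz.ne hζ
  have h1 := DiffContOnCl.circleAverage_smul_div (f := fun _ : ℂ => (1 : ℂ)) (c := 0) (R := R)
    (w := z) diffContOnCl_const (by simpa [abs_of_pos hR] using hz)
  have hi : CircleIntegrable (fun ζ : ℂ => ((ζ - 0) / (ζ - z)) • (1 : ℂ)) 0 R := by
    refine ContinuousOn.circleIntegrable hR.le ?_
    exact ((continuousOn_id.sub continuousOn_const).div (continuousOn_id.sub continuousOn_const)
      hne).smul continuousOn_const
  have h2 := Real.circleAverage_fun_sub hi (circleIntegrable_const (1 : ℂ) 0 R)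
  rw [h1, Real.circleAverage_const, sub_self] at h2
  refine Eq.trans ?_ h2
  refine Real.circleAverage_congr_sphere fun ζ hζ => ?_
  rw [abs_of_pos hR] at hζ
  have := hne ζ hζ
  simp only [sub_zero, smul_eq_mul, mul_one]
  field_simp
  ring

theorem circleAverage_div_sub_eq_one {z : ℂ} {r : ℝ} (hr : 0 < r) (hz : r < ‖z‖) :
    Real.circleAverage (fun ζ => z / (z - ζ)) 0 r = 1 := by
  have hz0 : z ≠ 0 := norm_pos_iff.1 (hr.trans hz)
  have hd : DiffContOnCl ℂ (fun ζ => z / (z - ζ)) (ball 0 |r|) := by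
    refine DifferentiableOn.diffContOnCl ?_
    refine (differentiableOn_const _).div (by fun_prop) ?_
    intro ζ hζ h
    have := closure_ball_subset_closedBall hζ
    rw [mem_closedBall_zero_iff, abs_of_pos hr, ← sub_eq_zero.1 h] at this
    exact this.not_gt hz
  rw [hd.circleAverage, sub_zero, div_self hz0]

/-- The Poisson kernel has average one. -/
theorem circleAverage_inv_norm_sq {z : ℂ} {R : ℝ} (hz : ‖z‖ < R) :
    Real.circleAverage (fun ζ => (‖ζ - z‖ ^ 2)⁻¹) 0 R = (R ^ 2 - ‖z‖ ^ 2)⁻¹ := by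
  have hR : 0 < R := (norm_nonneg z).trans_lt hz
  have hne : ∀ ζ ∈ sphere (0 : ℂ) R, ‖ζ - z‖ ^ 2 ≠ 0 := by
    intro ζ hζ h
    rw [sub_eq_zero.1 (norm_eq_zero.1 (pow_eq_zero_iff two_ne_zero |>.1 h)),
      mem_sphere_zero_iff_norm] at hζ
    exact hz.ne hζ
  have h1 := DiffContOnCl.circleAverage_poissonKernel_smul' (f := fun _ : ℂ => (1 : ℂ)) (c := 0)
    (R := R) (w := z) diffContOnCl_const (by simpa using hz)
  have hi : CircleIntegrable (fun ζ : ℂ => (‖ζ - z‖ ^ 2)⁻¹) 0 R :=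
    ContinuousOn.circleIntegrable hR.le
      (ContinuousOn.inv₀ (f := fun ζ : ℂ => ‖ζ - z‖ ^ 2) (by fun_prop) hne)
  have h2 := Complex.ofRealCLM.circleAverage_comp_comm hi
  have h3 : (R ^ 2 - ‖z‖ ^ 2) ≠ 0 := by nlinarith [norm_nonneg z]
  have h4 : ((R ^ 2 - ‖z‖ ^ 2 : ℝ) : ℂ) *
      ((Real.circleAverage (fun ζ => (‖ζ - z‖ ^ 2)⁻¹) 0 R : ℝ) : ℂ) = 1 := by
    rw [← Complex.ofRealCLM_apply (Real.circleAverage _ 0 R), ← h2, ← circleAverage_const_mul, ← h1]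
    refine Real.circleAverage_congr_sphere fun ζ hζ => ?_
    rw [abs_of_pos hR, mem_sphere_zero_iff_norm] at hζ
    simp [hζ, div_eq_mul_inv]
  rw [← Complex.ofReal_mul] at h4
  exact eq_inv_of_mul_eq_one_right (by exact_mod_cast h4)

section Laurent

variable {φ : ℂ → ℂ} {ρ r : ℝ}

theorem continuousOn_sphere_of_annulus (hφ : DifferentiableOn ℂ φ (annulus ρ)) {s : ℝ}
    (h1 : ρ < s) (h2 : s < ρ⁻¹) : ContinuousOn φ (sphere 0 s) := by
  refine hφ.continuousOn.mono fun ζ hζ => ?_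
  rw [mem_sphere_zero_iff_norm] at hζ
  exact ⟨by rwa [hζ], by rwa [hζ]⟩

theorem differentiableOn_laurentPlus {R : ℝ} (hR : 0 < R) (hφ : ContinuousOn φ (sphere 0 R)) :
    DifferentiableOn ℂ (laurentPlus φ R) (ball 0 R) := by
  have hi : CircleIntegrable (fun ζ => ζ⁻¹ * φ ζ) 0 R := by
    refine ContinuousOn.circleIntegrable hR.le (ContinuousOn.mul ?_ hφ)
    refine continuousOn_id.inv₀ fun ζ hζ h => ?_
    rw [id] at h
    rw [h, mem_sphere_zero_iff_norm, norm_zero] at hζ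
    exact hR.ne hζ
  lift R to ℝ≥0 using hR.le
  have h := (hasFPowerSeriesOn_cauchy_integral hi (by exact_mod_cast hR)).analyticOnNhd
  rw [Metric.eball_coe] at h
  refine (differentiableOn_id.mul h.differentiableOn).congr fun u _ => ?_
  rw [laurentPlus, Real.circleAverage_eq_circleIntegral hR.ne']
  change _ = u * _
  congr 2
  simp only [circleIntegral, smul_eq_mul, sub_zero]
  congr 1
  ext θ
  ring

/-- The divided difference of `φ` at `z` is holomorphic across `z`, so `z` times it has equal
averages over the two circles. On the outer circle the average is the positive part, since `z / (ζ -
z)` averages to `0`; on the inner one it is `φ z` minus the nonpositive part, since `z / (z - ζ)`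
averages to `1`. -/
theorem laurentPlus_add_laurentMinus (h0 : 0 < ρ) (hφ : DifferentiableOn ℂ φ (annulus ρ))
    (h1 : ρ < r) (h2 : r < 1) {z : ℂ} (hz : z ∈ annulus r) :
    laurentPlus φ r⁻¹ z + laurentMinus φ r z = φ z := by
  have hr : 0 < r := h0.trans h1
  have hz' : z ∈ annulus ρ := annulus_mono h0 h1.le hz
  have hR : r⁻¹ < ρ⁻¹ := (inv_lt_inv₀ hr h0).2 h1
  have hrR : r < r⁻¹ := h2.trans ((one_lt_inv₀ hr).2 h2)
  have hR0 : 0 < r⁻¹ := inv_pos.2 hr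
  have hds : DifferentiableOn ℂ (dslope φ z) (annulus ρ) :=
    (Complex.differentiableOn_dslope ((isOpen_annulus ρ).mem_nhds hz')).2 hφ
  have hshift := circleAverage_eq_of_differentiable (ψ := fun ζ => z * dslope φ z ζ) hr hrR.le
    fun ζ ha hb => (hds.differentiableAt ((isOpen_annulus ρ).mem_nhds
      ⟨h1.trans_le ha, hb.trans_lt hR⟩)).const_mul z
  have hneR : ∀ ζ ∈ sphere (0 : ℂ) r⁻¹, ζ - z ≠ 0 := by
    intro ζ hζ h
    rw [sub_eq_zero.1 h, mem_sphere_zero_iff_norm] at hζ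
    exact hz.2.ne hζ
  have hner : ∀ ζ ∈ sphere (0 : ℂ) r, z - ζ ≠ 0 := by
    intro ζ hζ h
    rw [← sub_eq_zero.1 h, mem_sphere_zero_iff_norm] at hζ
    exact hz.1.ne' hζ
  have hcR := continuousOn_sphere_of_annulus hφ (h1.trans hrR) hR
  have hcr := continuousOn_sphere_of_annulus hφ h1 (hrR.trans hR)
  have eR : Real.circleAverage (fun ζ => z * dslope φ z ζ) 0 r⁻¹ = laurentPlus φ r⁻¹ z := by
    have ha : CircleIntegrable (fun ζ => z * (φ ζ / (ζ - z))) 0 r⁻¹ :=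
      ContinuousOn.circleIntegrable hR0.le
        (continuousOn_const.mul (hcR.div (continuousOn_id.sub continuousOn_const) hneR))
    have hb : CircleIntegrable (fun ζ => φ z * (z / (ζ - z))) 0 r⁻¹ :=
      ContinuousOn.circleIntegrable hR0.le (continuousOn_const.mul
        (continuousOn_const.div (continuousOn_id.sub continuousOn_const) hneR))
    have hs := Real.circleAverage_fun_sub ha hb
    rw [circleAverage_const_mul, circleAverage_const_mul, circleAverage_div_sub_eq_zero hz.2,
      mul_zero, sub_zero] at hs
    rw [laurentPlus, ← hs]
    refine Real.circleAverage_congr_sphere fun ζ hζ => ?_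
    rw [abs_of_pos hR0] at hζ
    have := hneR ζ hζ
    rw [dslope_of_ne _ (sub_ne_zero.1 this), slope_def_field]
    field_simp
  have er : Real.circleAverage (fun ζ => z * dslope φ z ζ) 0 r = φ z - laurentMinus φ r z := by
    have ha : CircleIntegrable (fun ζ => z * (φ ζ / (z - ζ))) 0 r :=
      ContinuousOn.circleIntegrable hr.le
        (continuousOn_const.mul (hcr.div (continuousOn_const.sub continuousOn_id) hner))
    have hb : CircleIntegrable (fun ζ => φ z * (z / (z - ζ))) 0 r :=
      ContinuousOn.circleIntegrable hr.le (continuousOn_const.mul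
        (continuousOn_const.div (continuousOn_const.sub continuousOn_id) hner))
    have hs := Real.circleAverage_fun_sub hb ha
    rw [circleAverage_const_mul, circleAverage_const_mul, circleAverage_div_sub_eq_one hr hz.1,
      mul_one] at hs
    rw [laurentMinus, ← hs]
    refine Real.circleAverage_congr_sphere fun ζ hζ => ?_
    rw [abs_of_pos hr] at hζ
    have h := hner ζ hζ
    have h' : ζ - z ≠ 0 := fun h'' => h (by rw [← neg_sub, h'', neg_zero])
    rw [dslope_of_ne _ (sub_ne_zero.1 h'), slope_def_field]
    field_simp
    ring
  rw [← eR, hshift, er]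
  ring

/-- Moving the contour inwards to radius `r < 1` gives an expression that also makes sense for `r <
|z| ≤ 1`, hence the continuation across the circle. -/
theorem szegoExt_eq_laurentMinus (h0 : 0 < ρ) (hφ : DifferentiableOn ℂ φ (annulus ρ))
    (h1 : ρ < r) (h2 : r < 1) {f : ℂ → ℂ} (hf : EqOn f φ unitCircle) {z : ℂ} (hz : 1 < ‖z‖) :
    szegoExt f z = laurentMinus φ r z := by
  have hr : 0 < r := h0.trans h1
  have hρ1 : 1 < ρ⁻¹ := (one_lt_inv₀ h0).2 (h1.trans h2)
  rw [szegoExt, laurentMinus]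
  congr 1
  have := circleAverage_eq_of_differentiable (ψ := fun ζ => φ ζ / (z - ζ)) hr h2.le
    fun ζ ha hb => (hφ.differentiableAt ((isOpen_annulus ρ).mem_nhds
      ⟨h1.trans_le ha, hb.trans_lt hρ1⟩)).div (by fun_prop)
      (fun h => (hb.trans_lt hz).ne (by rw [sub_eq_zero.1 h]))
  rw [← this]
  refine Real.circleAverage_congr_sphere fun ζ hζ => ?_
  rw [hf (by simpa [unitCircle] using hζ)]

/-- With `u = 1 / conj z` and `|ζ| = 1`, the Poisson kernel equals `z / (z - ζ) + u / (ζ - u)`. The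
first term yields the nonpositive part at `z`, the second the positive part at `u`. -/
theorem poissonExt_eq (h0 : 0 < ρ) (hφ : DifferentiableOn ℂ φ (annulus ρ))
    (h1 : ρ < r) (h2 : r < 1) {f : ℂ → ℂ} (hf : EqOn f φ unitCircle) {z : ℂ} (hz : 1 < ‖z‖) :
    poissonExt f z = laurentMinus φ r z + laurentPlus φ r⁻¹ (conj z)⁻¹ := by
  have hr : 0 < r := h0.trans h1
  have hr1 : 1 < r⁻¹ := (one_lt_inv₀ hr).2 h2
  have hR : r⁻¹ < ρ⁻¹ := (inv_lt_inv₀ hr h0).2 h1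
  have hρ1 : 1 < ρ⁻¹ := hr1.trans hR
  have hz0 : z ≠ 0 := norm_pos_iff.1 (by linarith)
  have hcz0 : conj z ≠ 0 := (map_ne_zero _).2 hz0
  have hu : ‖(conj z)⁻¹‖ < 1 := by
    rw [norm_inv, Complex.norm_conj]; exact inv_lt_one_of_one_lt₀ hz
  have hc1 : ContinuousOn φ (sphere 0 1) := continuousOn_sphere_of_annulus hφ (h1.trans h2) hρ1
  have hplus : laurentPlus φ r⁻¹ (conj z)⁻¹ =
      (conj z)⁻¹ * Real.circleAverage (fun ζ => φ ζ / (ζ - (conj z)⁻¹)) 0 1 := by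
    rw [laurentPlus]
    congr 1
    exact circleAverage_eq_of_differentiable one_pos hr1.le
      fun ζ ha hb => (hφ.differentiableAt ((isOpen_annulus ρ).mem_nhds
        ⟨(h1.trans h2).trans_le ha, hb.trans_lt hR⟩)).div (by fun_prop)
        (fun h => (hu.trans_le ha).ne (by rw [sub_eq_zero.1 h]))
  have hne1 : ∀ ζ ∈ sphere (0 : ℂ) 1, z - ζ ≠ 0 := by
    intro ζ hζ h
    rw [← sub_eq_zero.1 h, mem_sphere_zero_iff_norm] at hζ
    exact hz.ne' hζ
  have hne2 : ∀ ζ ∈ sphere (0 : ℂ) 1, ζ - (conj z)⁻¹ ≠ 0 := by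
    intro ζ hζ h
    rw [sub_eq_zero.1 h, mem_sphere_zero_iff_norm] at hζ
    exact hu.ne hζ
  have ha : CircleIntegrable (fun ζ => z * (φ ζ / (z - ζ))) 0 1 :=
    ContinuousOn.circleIntegrable one_pos.le
      (continuousOn_const.mul (hc1.div (continuousOn_const.sub continuousOn_id) hne1))
  have hb : CircleIntegrable (fun ζ => (conj z)⁻¹ * (φ ζ / (ζ - (conj z)⁻¹))) 0 1 :=
    ContinuousOn.circleIntegrable one_pos.le
      (continuousOn_const.mul (hc1.div (continuousOn_id.sub continuousOn_const) hne2))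
  rw [← szegoExt_eq_laurentMinus h0 hφ h1 h2 (fun _ _ => rfl) hz, hplus, szegoExt,
    ← circleAverage_const_mul, ← circleAverage_const_mul, ← Real.circleAverage_fun_add ha hb,
    poissonExt, ← circleAverage_const_mul]
  refine Real.circleAverage_congr_sphere fun ζ hζ => ?_
  rw [abs_one] at hζ
  have g1 := hne1 ζ hζ
  have g2 := hne2 ζ hζ
  have hζ1 : ζ * conj ζ = 1 := by
    rw [Complex.mul_conj', mem_sphere_zero_iff_norm.1 hζ]; simp
  have g1' : conj z - conj ζ ≠ 0 := by
    rw [← map_sub]; exact (map_ne_zero _).2 g1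
  have e1 : ((‖z - ζ‖ ^ 2 : ℝ) : ℂ) = (z - ζ) * (conj z - conj ζ) := by
    rw [← map_sub, Complex.mul_conj']; push_cast; rfl
  have e2 : ((‖z‖ ^ 2 - 1 : ℝ) : ℂ) = z * conj z - 1 := by
    rw [Complex.mul_conj']; push_cast; rfl
  rw [hf (by simpa [unitCircle] using hζ), e1, e2]
  have hζ0 : ζ ≠ 0 := left_ne_zero_of_mul_eq_one hζ1
  have e3 : ζ - (conj z)⁻¹ = ζ * (conj z - conj ζ) / conj z := by
    field_simp
    linear_combination hζ1
  rw [e3]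
  field_simp
  linear_combination (z * φ ζ) * hζ1

theorem norm_laurentMinus_le {B : ℝ} (hr : 0 < r) (hB : ∀ ζ, ‖ζ‖ = r → ‖φ ζ‖ ≤ B)
    {z : ℂ} (hz : r < ‖z‖) (hφ : ContinuousOn φ (sphere 0 r)) :
    ‖laurentMinus φ r z‖ ≤ ‖z‖ * (B / (‖z‖ - r)) := by
  rw [laurentMinus, norm_mul]
  refine mul_le_mul_of_nonneg_left ((norm_circleAverage_le _ _).trans ?_) (norm_nonneg _)
  refine Real.circleAverage_mono_on_of_le_circle ?_ ?_
  · refine (ContinuousOn.norm (hφ.div (continuousOn_const.sub continuousOn_id)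
      fun ζ hζ h => ?_)).circleIntegrable hr.le
    have h' : z = ζ := sub_eq_zero.1 h
    rw [← h', mem_sphere_zero_iff_norm] at hζ
    exact hz.ne' hζ
  · intro ζ hζ
    rw [abs_of_pos hr, mem_sphere_zero_iff_norm] at hζ
    have := norm_sub_norm_le z ζ
    rw [norm_div]
    exact div_le_div₀ ((norm_nonneg _).trans (hB ζ hζ)) (hB ζ hζ) (by linarith) (by linarith)

/-- A crude bound on the two Cauchy kernels would cost `(R - m)⁻²` and spoil the exponent in the
theorem. Estimating their product by half the sum of squares and averaging with the Poisson kernel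
costs a single `(R - m)⁻¹`. -/
theorem norm_laurentPlus_sub_le {R m B : ℝ} (hB : ∀ ζ, ‖ζ‖ = R → ‖φ ζ‖ ≤ B)
    (hφ : ContinuousOn φ (sphere 0 R)) (hm : m < R) {z u : ℂ} (hz : ‖z‖ ≤ m) (hu : ‖u‖ ≤ m) :
    ‖laurentPlus φ R z - laurentPlus φ R u‖ ≤ ‖z - u‖ * (B / (R - m)) := by
  have hm0 : 0 ≤ m := (norm_nonneg z).trans hz
  have hR : 0 < R := hm0.trans_lt hm
  have hB0 : 0 ≤ B := (norm_nonneg _).trans (hB R (by simp [hR.le]))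
  have hne : ∀ x : ℂ, ‖x‖ ≤ m → ∀ ζ ∈ sphere (0 : ℂ) R, ζ - x ≠ 0 := by
    intro x hx ζ hζ h
    rw [sub_eq_zero.1 h, mem_sphere_zero_iff_norm] at hζ
    linarith
  have hi : ∀ x : ℂ, ‖x‖ ≤ m → CircleIntegrable (fun ζ => x * (φ ζ / (ζ - x))) 0 R := fun x hx =>
    ContinuousOn.circleIntegrable hR.le
      (continuousOn_const.mul (hφ.div (continuousOn_id.sub continuousOn_const) (hne x hx)))
  have hsq : ∀ x : ℂ, ‖x‖ ≤ m → CircleIntegrable (fun ζ : ℂ => (‖ζ - x‖ ^ 2)⁻¹) 0 R :=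
    fun x hx => ContinuousOn.circleIntegrable hR.le
      (ContinuousOn.inv₀ (f := fun ζ : ℂ => ‖ζ - x‖ ^ 2) (by fun_prop)
        fun ζ hζ => pow_ne_zero 2 (norm_ne_zero_iff.2 (hne x hx ζ hζ)))
  have e : laurentPlus φ R z - laurentPlus φ R u =
      (z - u) * Real.circleAverage (fun ζ => φ ζ * ζ / ((ζ - z) * (ζ - u))) 0 R := by
    rw [laurentPlus, laurentPlus, ← circleAverage_const_mul, ← circleAverage_const_mul,
      ← circleAverage_const_mul, ← Real.circleAverage_fun_sub (hi z hz) (hi u hu)]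
    refine Real.circleAverage_congr_sphere fun ζ hζ => ?_
    rw [abs_of_pos hR] at hζ
    have g1 := hne z hz ζ hζ
    have g2 := hne u hu ζ hζ
    field_simp
    ring
  rw [e, norm_mul]
  refine mul_le_mul_of_nonneg_left ((norm_circleAverage_le _ _).trans ?_) (norm_nonneg _)
  have hle : ∀ ζ ∈ sphere (0 : ℂ) |R|, ‖φ ζ * ζ / ((ζ - z) * (ζ - u))‖ ≤
      (B * R / 2) * ((‖ζ - z‖ ^ 2)⁻¹ + (‖ζ - u‖ ^ 2)⁻¹) := by
    intro ζ hζ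
    rw [abs_of_pos hR] at hζ
    have g1 := norm_pos_iff.2 (hne z hz ζ hζ)
    have g2 := norm_pos_iff.2 (hne u hu ζ hζ)
    rw [mem_sphere_zero_iff_norm] at hζ
    rw [norm_div, norm_mul, norm_mul, hζ, div_eq_mul_inv, mul_inv, ← inv_pow, ← inv_pow]
    have h1 := two_mul_le_add_sq ‖ζ - z‖⁻¹ ‖ζ - u‖⁻¹
    have h2 : ‖φ ζ‖ * R ≤ B * R := mul_le_mul_of_nonneg_right (hB ζ hζ) hR.le
    have h3 : 0 ≤ ‖ζ - z‖⁻¹ * ‖ζ - u‖⁻¹ := by positivity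
    have h4 : 0 ≤ B * R := by positivity
    nlinarith [mul_le_mul_of_nonneg_right h2 h3, mul_le_mul_of_nonneg_left h1 h4]
  have hconst : ∀ a : ℝ, ∀ g : ℂ → ℝ, Real.circleAverage (fun ζ => a * g ζ) 0 R =
      a * Real.circleAverage g 0 R := fun a g => Real.circleAverage_fun_smul (a := a)
  have hmono := Real.circleAverage_mono (c := 0) (R := R) ?_ ?_ hle
  rotate_left
  · refine (ContinuousOn.norm ?_).circleIntegrable hR.le
    refine (hφ.mul continuousOn_id).div ((continuousOn_id.sub continuousOn_const).mul
      (continuousOn_id.sub continuousOn_const)) fun ζ hζ =>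
        mul_ne_zero (hne z hz ζ hζ) (hne u hu ζ hζ)
  · exact ((hsq z hz).add (hsq u hu)).const_mul _
  refine hmono.trans ?_
  rw [hconst, Real.circleAverage_fun_add (hsq z hz) (hsq u hu),
    circleAverage_inv_norm_sq (hz.trans_lt hm), circleAverage_inv_norm_sq (hu.trans_lt hm)]
  have hk : ∀ x : ℂ, ‖x‖ ≤ m → (R ^ 2 - ‖x‖ ^ 2)⁻¹ ≤ (R * (R - m))⁻¹ := by
    intro x hx
    refine inv_anti₀ (mul_pos hR (by linarith)) ?_
    nlinarith [norm_nonneg x, mul_nonneg hm0 (show 0 ≤ R - m by linarith)]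
  calc B * R / 2 * ((R ^ 2 - ‖z‖ ^ 2)⁻¹ + (R ^ 2 - ‖u‖ ^ 2)⁻¹)
      ≤ B * R / 2 * ((R * (R - m))⁻¹ + (R * (R - m))⁻¹) :=
        mul_le_mul_of_nonneg_left (add_le_add (hk z hz) (hk u hu)) (by positivity)
    _ = B / (R - m) := by
        have : R - m ≠ 0 := by linarith
        field_simp
        ring

end Laurent

/-! ### The projection and the division operator on polarizations -/

/-- The restriction to the circle, extended holomorphically to the annulus. -/
def antidiag (K : ℂ × ℂ → ℂ) (ζ : ℂ) : ℂ := K (ζ, ζ⁻¹)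

/-- The polarization of the projection to `H²₋`. -/
def projMinusPol (K : ℂ × ℂ → ℂ) (τ : ℝ) (p : ℂ × ℂ) : ℂ :=
  antidiag K p.1 - laurentPlus (antidiag K) (rho τ)⁻¹ p.1

/-- The polarization of the harmonic extension. -/
def harmExtPol (K : ℂ × ℂ → ℂ) (τ : ℝ) (p : ℂ × ℂ) : ℂ :=
  projMinusPol K τ p + laurentPlus (antidiag K) (rho τ)⁻¹ p.2⁻¹

/-- The polarization of the division operator. -/
def opMPol (K : ℂ × ℂ → ℂ) (τ : ℝ) (p : ℂ × ℂ) : ℂ :=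
  -p.1⁻¹ * dslope (fun v => K (p.1, v) - harmExtPol K τ (p.1, v)) p.1⁻¹ p.2

/-- By construction `harmExtPol K τ` agrees with `K` on `v = 1/z`, so the difference quotient there
loses its subtracted value; also `1 - z v = -z (v - 1/z)`. -/
theorem opMPol_of_ne {K : ℂ × ℂ → ℂ} {τ : ℝ} {p : ℂ × ℂ} (h0 : p.1 ≠ 0) (h1 : p.1 * p.2 ≠ 1) :
    opMPol K τ p = (K p - harmExtPol K τ p) / (1 - p.1 * p.2) := by
  have hne : p.2 ≠ p.1⁻¹ := fun h => h1 (by rw [h, mul_inv_cancel₀ h0])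
  have h2 : p.2 - p.1⁻¹ ≠ 0 := sub_ne_zero.2 hne
  have h3 : 1 - p.1 * p.2 ≠ 0 := fun h => h1 (sub_eq_zero.1 h).symm
  have h4 : harmExtPol K τ (p.1, p.1⁻¹) = K (p.1, p.1⁻¹) := by
    simp [harmExtPol, projMinusPol, antidiag]
  have h5 : 1 - p.1 * p.2 = -p.1 * (p.2 - p.1⁻¹) := by field_simp; ring
  rw [opMPol, dslope_of_ne _ hne, slope_def_field, h4, sub_self, sub_zero, h5]
  field_simp

/-- Division by a coordinate hyperbola: the divided difference is holomorphic. -/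
theorem differentiableOn_dslope_slice {N : ℂ × ℂ → ℂ} {U : Set (ℂ × ℂ)} (hU : IsOpen U)
    (hN : DifferentiableOn ℂ N U) (hinv : ∀ p ∈ U, p.1 ≠ 0 ∧ (p.1, p.1⁻¹) ∈ U) :
    DifferentiableOn ℂ (fun p => dslope (fun v => N (p.1, v)) p.1⁻¹ p.2) U := by
  have hoff : ∀ p ∈ U, p.2 ≠ p.1⁻¹ →
      DifferentiableAt ℂ (fun p => dslope (fun v => N (p.1, v)) p.1⁻¹ p.2) p := by
    intro p hp hne
    have h0 := (hinv p hp).1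
    have hd1 : DifferentiableAt ℂ (fun p : ℂ × ℂ => p.1⁻¹) p := differentiableAt_fst.inv h0
    have hd2 : DifferentiableAt ℂ (fun p : ℂ × ℂ => N (p.1, p.1⁻¹)) p :=
      DifferentiableAt.comp (g := N) p (hN.differentiableAt (hU.mem_nhds (hinv p hp).2))
        (differentiableAt_fst.prodMk hd1)
    have hd4 : DifferentiableAt ℂ (fun p : ℂ × ℂ => p.2 - p.1⁻¹) p := differentiableAt_snd.sub hd1
    have hd3 : DifferentiableAt ℂ (fun p : ℂ × ℂ => (N p - N (p.1, p.1⁻¹)) * (p.2 - p.1⁻¹)⁻¹) p :=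
      ((hN.differentiableAt (hU.mem_nhds hp)).sub hd2).mul (hd4.inv (sub_ne_zero.2 hne))
    refine hd3.congr_of_eventuallyEq ?_
    have hcont : ContinuousAt (fun p : ℂ × ℂ => p.2 - p.1⁻¹) p :=
      hd4.continuousAt
    filter_upwards [hcont.eventually_ne (sub_ne_zero.2 hne)] with q hq
    rw [dslope_of_ne _ (sub_ne_zero.1 hq), slope_def_field, div_eq_mul_inv]
  have hslice : ∀ z v, (z, v) ∈ U →
      DifferentiableOn ℂ (dslope (fun v => N (z, v)) z⁻¹) {v | (z, v) ∈ U} := by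
    intro z v hv
    have hopen : IsOpen {v | (z, v) ∈ U} := hU.preimage (Continuous.prodMk_right z)
    refine (Complex.differentiableOn_dslope (hopen.mem_nhds (hinv _ hv).2)).2 ?_
    exact hN.comp (by fun_prop) fun w hw => hw
  rintro ⟨a, c⟩ hp
  by_cases hne : c ≠ a⁻¹
  · exact (hoff _ hp hne).differentiableWithinAt
  obtain rfl : c = a⁻¹ := not_not.1 hne
  have ha : a ≠ 0 := (hinv _ hp).1
  obtain ⟨s, hs, hsU⟩ := Metric.nhds_basis_closedBall.mem_iff.1 (hU.mem_nhds hp)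
  have hinvc : ∀ᶠ z in 𝓝 a, z⁻¹ ∈ ball a⁻¹ s :=
    (continuousAt_inv₀ ha).eventually (Metric.ball_mem_nhds _ hs)
  -- The first radius is chosen so small that `1/z` stays inside the second disc. The product of the
  -- first disc with the second circle then avoids the hyperbola, and separate holomorphy suffices
  -- for `analyticOnNhd_bidisc`.
  obtain ⟨t, ht, htU⟩ := Metric.nhds_basis_closedBall.mem_iff.1 hinvc
  set r := min s t with hr_def
  have hr : 0 < r := lt_min hs ht
  have hmem : ∀ {z v}, z ∈ closedBall a r → v ∈ closedBall a⁻¹ s → (z, v) ∈ U := by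
    intro z v hz hv
    refine hsU ?_
    rw [← closedBall_prod_same]
    exact ⟨closedBall_subset_closedBall (min_le_left _ _) hz, hv⟩
  have hsph : ∀ {z v}, z ∈ closedBall a r → v ∈ sphere a⁻¹ s → v ≠ z⁻¹ := by
    rintro z v hz hv rfl
    exact (mem_ball.1 (htU (closedBall_subset_closedBall (min_le_right _ _) hz))).ne hv
  have hcl : closure (ball a r) ⊆ closedBall a r := closure_ball_subset_closedBall
  refine (analyticOnNhd_bidisc hr hs ?_ ?_ ?_ (a, a⁻¹)
    ⟨mem_ball_self hr, mem_ball_self hs⟩).differentiableAt.differentiableWithinAt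
  · rintro ⟨z, v⟩ ⟨hz, hv⟩
    have hz' := sphere_subset_closedBall hz
    exact (hoff (z, v) (hmem hz' (sphere_subset_closedBall hv))
      (hsph hz' hv)).continuousAt.continuousWithinAt
  · intro ξ hξ
    refine DifferentiableOn.diffContOnCl fun z hz => ?_
    exact (DifferentiableAt.comp (f := fun z : ℂ => (z, ξ)) z
      (hoff (z, ξ) (hmem (hcl hz) (sphere_subset_closedBall hξ)) (hsph (hcl hz) hξ))
      (by fun_prop)).differentiableWithinAt
  · intro z hz
    refine DifferentiableOn.diffContOnCl ?_
    exact (hslice z a⁻¹ (hmem (ball_subset_closedBall hz) (mem_closedBall_self hs.le))).mono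
      fun v hv => hmem (ball_subset_closedBall hz) (closure_ball_subset_closedBall hv)

namespace HasPol

variable {σ σ' τ B : ℝ} {f : ℂ → ℂ} {K : ℂ × ℂ → ℂ}

theorem differentiableOn_antidiag (hK : HasPol σ f K B) :
    DifferentiableOn ℂ (antidiag K) (annulus (rho σ)) := by
  refine hK.diff.comp (differentiableOn_id.prodMk (differentiableOn_id.inv fun z hz => ?_))
    fun z hz => mk_inv_mem_holDomain hz
  exact ne_zero_of_mem_annulus (rho_pos σ) hz

theorem eqOn_antidiag (hK : HasPol σ f K B) : EqOn f (antidiag K) unitCircle := by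
  intro z hz
  have h1 : ‖z‖ = 1 := by simpa [unitCircle] using hz
  have h2 : z⁻¹ = conj z := Complex.inv_eq_conj h1
  rw [antidiag, h2]
  exact (hK.diag.self_of_nhdsSet z hz).symm

theorem norm_antidiag_le (hK : HasPol σ f K B) {z : ℂ} (hz : z ∈ annulus (rho σ)) :
    ‖antidiag K z‖ ≤ B := hK.bound _ (mk_inv_mem_holDomain hz)

theorem differentiableOn_laurentPlus (hK : HasPol σ f K B) (h0 : 0 < τ) (h : rho σ < rho τ) :
    DifferentiableOn ℂ (laurentPlus (antidiag K) (rho τ)⁻¹) (ball 0 (rho τ)⁻¹) := by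
  refine SoftRH.differentiableOn_laurentPlus (inv_pos.2 (rho_pos τ))
    (continuousOn_sphere_of_annulus hK.differentiableOn_antidiag ?_ ?_)
  · exact h.trans ((rho_lt_one h0).trans (one_lt_rho_inv h0))
  · exact (inv_lt_inv₀ (rho_pos τ) (rho_pos σ)).2 h

theorem projMinusPol_eq (hK : HasPol σ f K B) (h0 : 0 < τ) (h : rho σ < rho τ) {p : ℂ × ℂ}
    (hp : p.1 ∈ annulus (rho τ)) :
    projMinusPol K τ p = laurentMinus (antidiag K) (rho τ) p.1 := by
  rw [projMinusPol, ← laurentPlus_add_laurentMinus (rho_pos σ) hK.differentiableOn_antidiag h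
    (rho_lt_one h0) hp, add_sub_cancel_left]

theorem differentiableOn_projMinusPol (hK : HasPol σ f K B) (h0 : 0 < τ) (h : rho σ < rho τ) :
    DifferentiableOn ℂ (projMinusPol K τ) (holDomain τ) := by
  refine DifferentiableOn.sub ?_ ?_
  · exact hK.differentiableOn_antidiag.comp differentiableOn_fst fun p hp =>
      annulus_mono (rho_pos σ) h.le (mem_holDomain.1 hp).1
  · exact (hK.differentiableOn_laurentPlus h0 h).comp differentiableOn_fst fun p hp =>
      mem_ball_zero_iff.2 (mem_holDomain.1 hp).1.2

theorem differentiableOn_harmExtPol (hK : HasPol σ f K B) (h0 : 0 < τ) (h : rho σ < rho τ) :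
    DifferentiableOn ℂ (harmExtPol K τ) (holDomain τ) := by
  refine (hK.differentiableOn_projMinusPol h0 h).add ?_
  refine (hK.differentiableOn_laurentPlus h0 h).comp
    (differentiableOn_snd.inv fun p hp => ?_) fun p hp => ?_
  · exact ne_zero_of_mem_annulus (rho_pos τ) (mem_holDomain.1 hp).2.1
  · exact mem_ball_zero_iff.2 (inv_mem_annulus (rho_pos τ) (mem_holDomain.1 hp).2.1).2

theorem differentiableOn_opMPol (hK : HasPol σ f K B) (h0 : 0 < τ) (hτ : τ < σ) (h1 : σ ≤ 1) :
    DifferentiableOn ℂ (opMPol K τ) (holDomain τ) := by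
  have h : rho σ < rho τ := by linarith [rho_gap h0.le hτ.le h1]
  refine DifferentiableOn.mul ?_ (differentiableOn_dslope_slice (isOpen_holDomain τ)
    (N := fun p => K p - harmExtPol K τ p) ?_ fun p hp => ?_)
  · exact (differentiableOn_fst.inv fun p hp =>
      ne_zero_of_mem_annulus (rho_pos τ) (mem_holDomain.1 hp).1).neg
  · exact (hK.diff.mono (holDomain_mono h0.le hτ.le h1)).sub (hK.differentiableOn_harmExtPol h0 h)
  · exact ⟨ne_zero_of_mem_annulus (rho_pos τ) (mem_holDomain.1 hp).1,
      mk_inv_mem_holDomain (mem_holDomain.1 hp).1⟩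

theorem projMinus_eventuallyEq (hK : HasPol σ f K B) (h0 : 0 < τ) (h : rho σ < rho τ) :
    projMinus f =ᶠ[𝓝ˢ unitCircle] fun z => projMinusPol K τ (z, conj z) := by
  refine acrossCircle_eventuallyEq
    ⟨analyticOnNhd_diag h0 (hK.differentiableOn_projMinusPol h0 h), ?_⟩
  filter_upwards [eventually_mk_conj_mem_holDomain h0] with z hz hz1
  rw [hK.projMinusPol_eq h0 h (mem_holDomain.1 hz).1,
    szegoExt_eq_laurentMinus (rho_pos σ) hK.differentiableOn_antidiag h (rho_lt_one h0)
      hK.eqOn_antidiag hz1]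

theorem harmExt_eventuallyEq (hK : HasPol σ f K B) (h0 : 0 < τ) (h : rho σ < rho τ) :
    harmExt f =ᶠ[𝓝ˢ unitCircle] fun z => harmExtPol K τ (z, conj z) := by
  refine acrossCircle_eventuallyEq
    ⟨analyticOnNhd_diag h0 (hK.differentiableOn_harmExtPol h0 h), ?_⟩
  filter_upwards [eventually_mk_conj_mem_holDomain h0] with z hz hz1
  rw [harmExtPol, hK.projMinusPol_eq h0 h (mem_holDomain.1 hz).1,
    poissonExt_eq (rho_pos σ) hK.differentiableOn_antidiag h (rho_lt_one h0)
      hK.eqOn_antidiag hz1]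

theorem opM_eventuallyEq (hK : HasPol σ f K B) (h0 : 0 < τ) (hτ : τ < σ) (h1 : σ ≤ 1) :
    opM f =ᶠ[𝓝ˢ unitCircle] fun z => opMPol K τ (z, conj z) := by
  have h : rho σ < rho τ := by linarith [rho_gap h0.le hτ.le h1]
  refine acrossCircle_eventuallyEq
    ⟨analyticOnNhd_diag h0 (hK.differentiableOn_opMPol h0 hτ h1), ?_⟩
  filter_upwards [hK.harmExt_eventuallyEq h0 h, hK.diag] with z hz hz' hz1
  have hm : z * conj z = ((‖z‖ ^ 2 : ℝ) : ℂ) := by rw [Complex.mul_conj']; push_cast; rfl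
  rw [opMPol_of_ne (norm_pos_iff.1 (show 0 < ‖z‖ by linarith)), hz, ← hz']
  · simp only [hm]
    push_cast
    rfl
  · simp only [hm]
    intro hc
    have : ‖z‖ ^ 2 = 1 := by exact_mod_cast hc
    nlinarith

theorem projMinus (hK : HasPol σ f K B) (h0 : 0 < σ') (hσ : σ' < σ) (h1 : σ ≤ 1) :
    HasPol σ' (projMinus f) (projMinusPol K ((σ + σ') / 2)) (30 / (σ - σ') * B) := by
  -- The contour sits at radius `rho τ`, halfway: `K` is bounded on it, and it keeps distance `(σ -
  -- σ') / 12` from the points considered. With `|z| ≤ 5/2` this gives `30`.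
  set τ := (σ + σ') / 2 with hτ
  have hB := hK.nonneg (h0.trans hσ)
  have h0τ : 0 < τ := by linarith
  have g1 := rho_gap h0τ.le (show τ ≤ σ by linarith) h1
  have g2 := rho_gap h0.le (show σ' ≤ τ by linarith) (by linarith)
  have h : rho σ < rho τ := by linarith
  refine ⟨(hK.differentiableOn_projMinusPol h0τ h).mono
    (holDomain_mono h0.le (by linarith) (by linarith)), fun p hp => ?_, ?_⟩
  · have hp1 := (mem_holDomain.1 hp).1
    have hp1τ : p.1 ∈ annulus (rho τ) := annulus_mono (rho_pos τ) (by linarith) hp1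
    rw [hK.projMinusPol_eq h0τ h hp1τ]
    have hr1 := (rho_lt_one h0τ).trans (one_lt_rho_inv h0τ)
    have hr2 : (rho τ)⁻¹ < (rho σ)⁻¹ := (inv_lt_inv₀ (rho_pos τ) (rho_pos σ)).2 h
    have hb := norm_laurentMinus_le (φ := antidiag K) (B := B) (rho_pos τ)
      (fun ζ hζ => hK.norm_antidiag_le ⟨by rwa [hζ], by rw [hζ]; exact hr1.trans hr2⟩) hp1τ.1
      (continuousOn_sphere_of_annulus hK.differentiableOn_antidiag h (hr1.trans hr2))
    refine hb.trans ?_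
    have e1 : ‖p.1‖ ≤ 5 / 2 := hp1.2.le.trans (rho_inv_le (by linarith) h0.le)
    have e2 : (σ - σ') / 12 ≤ ‖p.1‖ - rho τ := by linarith [hp1.1]
    have e3 : B / (‖p.1‖ - rho τ) ≤ B / ((σ - σ') / 12) :=
      div_le_div_of_nonneg_left hB (by linarith) e2
    have e4 : 0 ≤ B / ((σ - σ') / 12) := div_nonneg hB (by linarith)
    calc ‖p.1‖ * (B / (‖p.1‖ - rho τ)) ≤ 5 / 2 * (B / ((σ - σ') / 12)) :=
          mul_le_mul e1 e3 (div_nonneg hB (by linarith)) (by norm_num)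
      _ = 30 / (σ - σ') * B := by
          have : σ - σ' ≠ 0 := by linarith
          field_simp
          ring
  · filter_upwards [hK.projMinus_eventuallyEq h0τ h] with z hz
    rw [hz]

/-- The slice need not be convex, so no mean value inequality along a segment is used: if `s` is
within `(σ - σ') / 6` of `p.2` the Schwarz lemma on that disc applies, and otherwise the trivial
bound `2 * B` is enough. -/
theorem norm_slice_sub_le (hK : HasPol σ f K B) (h0 : 0 < σ') (hσ : σ' < σ) (h1 : σ ≤ 1)
    {p : ℂ × ℂ} (hp : p ∈ holDomain σ') {s : ℂ} (hs : (p.1, s) ∈ holDomain σ) :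
    ‖K p - K (p.1, s)‖ ≤ 12 / (σ - σ') * B * ‖s - p.2‖ := by
  have hB := hK.nonneg (h0.trans hσ)
  have hpσ := holDomain_mono h0.le hσ.le h1 hp
  have hδ : 0 < (σ - σ') / 6 := by linarith
  have h2B : ∀ v, (p.1, v) ∈ holDomain σ → ‖K (p.1, v) - K p‖ ≤ 2 * B := fun v hv =>
    (norm_sub_le _ _).trans (by linarith [hK.bound _ hv, hK.bound _ hpσ])
  have hc : 12 / (σ - σ') * B = 2 * B / ((σ - σ') / 6) := by
    have : σ - σ' ≠ 0 := by linarith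
    field_simp
    ring
  rw [norm_sub_rev, hc]
  rcases lt_or_ge ‖s - p.2‖ ((σ - σ') / 6) with hlt | hge
  · have hball : ∀ v ∈ ball p.2 ((σ - σ') / 6), (p.1, v) ∈ holDomain σ := fun v hv =>
      holDomain_ball h0.le hσ.le h1 hp (mem_ball_iff_norm.1 hv).le
    have := Complex.dist_le_div_mul_dist_of_mapsTo_ball (f := fun v => K (p.1, v)) (c := p.2)
      (R₁ := (σ - σ') / 6) (R₂ := 2 * B) (z := s)
      (hK.diff.comp (by fun_prop) hball)
      (fun v hv => mem_closedBall_iff_norm.2 (h2B v (hball v hv))) (mem_ball_iff_norm.2 hlt)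
    rwa [dist_eq_norm, dist_eq_norm] at this
  · refine (h2B s hs).trans ?_
    rw [div_mul_eq_mul_div, le_div_iff₀ hδ]
    exact mul_le_mul_of_nonneg_left hge (by linarith)

theorem norm_opMPol_le_of_ne (hK : HasPol σ f K B) (h0 : 0 < σ') (hσ : σ' < σ) (h1 : σ ≤ 1)
    {p : ℂ × ℂ} (hp : p ∈ holDomain σ') (hne : p.1 * p.2 ≠ 1) :
    ‖opMPol K ((σ + σ') / 2) p‖ ≤ 35 / (σ - σ') * B := by
  set τ := (σ + σ') / 2 with hτ
  have hB := hK.nonneg (h0.trans hσ)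
  have h0τ : 0 < τ := by linarith
  have g1 := rho_gap h0τ.le (show τ ≤ σ by linarith) h1
  have h : rho σ < rho τ := by linarith
  have g3 := rho_inv_gap h0.le (show σ' ≤ τ by linarith)
  have hδ : 0 < σ - σ' := by linarith
  obtain ⟨hp1, hp2, -⟩ := mem_holDomain.1 hp
  have hn1 : p.1 ≠ 0 := ne_zero_of_mem_annulus (rho_pos σ') hp1
  have hn2 : p.2 ≠ 0 := ne_zero_of_mem_annulus (rho_pos σ') hp2
  have hle := le_rho (show σ' ≤ 1 by linarith) h0.le
  have hp1σ : p.1 ∈ annulus (rho σ) :=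
    annulus_mono (rho_pos σ) (by linarith [rho_gap h0.le hσ.le h1]) hp1
  rw [opMPol_of_ne hn1 hne, norm_div, div_le_iff₀
    (norm_pos_iff.2 (sub_ne_zero.2 (Ne.symm hne)))]
  -- Both brackets vanish on `z v = 1`. Since `1/z - v` and `z - 1/v` are at most `5/2 |1 - z v|` in
  -- modulus, the constants are `12 · 5/2 + 2 · 5/2 = 35`.
  have hsplit : K p - harmExtPol K τ p = (K p - K (p.1, p.1⁻¹)) +
      (laurentPlus (antidiag K) (rho τ)⁻¹ p.1 - laurentPlus (antidiag K) (rho τ)⁻¹ p.2⁻¹) := by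
    simp only [harmExtPol, projMinusPol, antidiag]
    ring
  have hA := hK.norm_slice_sub_le h0 hσ h1 hp (mk_inv_mem_holDomain hp1σ)
  have hr1 := (rho_lt_one h0τ).trans (one_lt_rho_inv h0τ)
  have hr2 : (rho τ)⁻¹ < (rho σ)⁻¹ := (inv_lt_inv₀ (rho_pos τ) (rho_pos σ)).2 h
  have hm : (rho σ')⁻¹ < (rho τ)⁻¹ := by linarith
  have hBd := norm_laurentPlus_sub_le (φ := antidiag K) (R := (rho τ)⁻¹) (m := (rho σ')⁻¹) (B := B)
    (fun ζ hζ => hK.norm_antidiag_le ⟨by rw [hζ]; exact h.trans hr1, by rwa [hζ]⟩)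
    (continuousOn_sphere_of_annulus hK.differentiableOn_antidiag (h.trans hr1) hr2) hm
    hp1.2.le (inv_mem_annulus (rho_pos σ') hp2).2.le
  have hden : B / ((rho τ)⁻¹ - (rho σ')⁻¹) ≤ 2 / (σ - σ') * B := by
    rw [div_mul_eq_mul_div, div_le_div_iff₀ (by linarith) hδ]
    nlinarith
  set d := ‖1 - p.1 * p.2‖ with hd
  have hd1 : ‖p.1⁻¹ - p.2‖ ≤ 5 / 2 * d := by
    have e : p.1⁻¹ - p.2 = p.1⁻¹ * (1 - p.1 * p.2) := by field_simp
    rw [e, norm_mul]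
    exact mul_le_mul_of_nonneg_right ((inv_mem_annulus (rho_pos σ') hp1).2.le.trans
      (rho_inv_le (by linarith) h0.le)) (norm_nonneg _)
  have hd2 : ‖p.1 - p.2⁻¹‖ ≤ 5 / 2 * d := by
    have e : p.1 - p.2⁻¹ = -p.2⁻¹ * (1 - p.1 * p.2) := by field_simp; ring
    rw [e, norm_mul, norm_neg]
    exact mul_le_mul_of_nonneg_right ((inv_mem_annulus (rho_pos σ') hp2).2.le.trans
      (rho_inv_le (by linarith) h0.le)) (norm_nonneg _)
  rw [hsplit]
  refine (norm_add_le _ _).trans ((add_le_add hA hBd).trans ?_)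
  have hc1 : 0 ≤ 12 / (σ - σ') * B := by positivity
  have hc2 : 0 ≤ 2 / (σ - σ') * B := by positivity
  calc 12 / (σ - σ') * B * ‖p.1⁻¹ - p.2‖ + ‖p.1 - p.2⁻¹‖ * (B / ((rho τ)⁻¹ - (rho σ')⁻¹))
      ≤ 12 / (σ - σ') * B * (5 / 2 * d) + 5 / 2 * d * (2 / (σ - σ') * B) :=
        add_le_add (mul_le_mul_of_nonneg_left hd1 hc1)
          ((mul_le_mul_of_nonneg_left hden (norm_nonneg _)).trans
            (mul_le_mul_of_nonneg_right hd2 hc2))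
    _ = 35 / (σ - σ') * B * d := by
        field_simp
        ring

theorem opM (hK : HasPol σ f K B) (h0 : 0 < σ') (hσ : σ' < σ) (h1 : σ ≤ 1) :
    HasPol σ' (opM f) (opMPol K ((σ + σ') / 2)) (35 / (σ - σ') * B) := by
  have h0τ : 0 < (σ + σ') / 2 := by linarith
  have hdiff : DifferentiableOn ℂ (opMPol K ((σ + σ') / 2)) (holDomain σ') :=
    (hK.differentiableOn_opMPol h0τ (by linarith) h1).mono
      (holDomain_mono h0.le (by linarith) (by linarith))
  refine ⟨hdiff, fun p hp => ?_, ?_⟩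
  · by_cases hne : p.1 * p.2 ≠ 1
    · exact hK.norm_opMPol_le_of_ne h0 hσ h1 hp hne
    have hp0 : p.1 ≠ 0 := left_ne_zero_of_mul_eq_one (not_not.1 hne)
    have hc : Tendsto (fun v : ℂ => (p.1, v)) (𝓝 p.2) (𝓝 p) :=
      (Continuous.prodMk_right p.1).tendsto p.2
    have hcont := ((hdiff.differentiableAt
      ((isOpen_holDomain σ').mem_nhds hp)).continuousAt.tendsto.comp hc).norm
    -- On the hyperbola the bound follows by continuity, letting `v` tend to `p.2` through other
    -- values.
    refine le_of_tendsto (hcont.mono_left (nhdsWithin_le_nhds (s := {p.2}ᶜ))) ?_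
    filter_upwards [self_mem_nhdsWithin,
      nhdsWithin_le_nhds (hc ((isOpen_holDomain σ').mem_nhds hp))] with v hv hv'
    refine hK.norm_opMPol_le_of_ne h0 hσ h1 hv' fun h => hv ?_
    exact mul_left_cancel₀ hp0 (h.trans (not_not.1 hne).symm)
  · filter_upwards [hK.opM_eventuallyEq h0τ (by linarith) h1] with z hz
    rw [hz]

end HasPol

/-! ### From bounds to the Banach space norms -/

theorem MemHInf.hasPol {σ : ℝ} {f : ℂ → ℂ} (h : MemHInf σ f) :
    HasPol σ f (fun p => polarize σ f (p.1, conj p.2)) (polNorm σ (polarize σ f)).toReal := by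
  have hp : IsPolarization σ f (polarize σ f) := Classical.epsilon_spec h
  refine ⟨hp.holomorphic, fun p hpσ => ?_, ?_⟩
  · rw [← toReal_enorm]
    exact ENNReal.toReal_mono hp.bounded.ne
      (le_iSup₂ (f := fun p (_ : p ∈ polDomain σ) => ‖polarize σ f p‖ₑ) _ hpσ)
  · simpa using hp.diagonal

theorem MemHInf.polNorm_lt_top {σ : ℝ} {f : ℂ → ℂ} (h : MemHInf σ f) :
    polNorm σ (polarize σ f) < ∞ :=
  (show IsPolarization σ f (polarize σ f) from Classical.epsilon_spec h).bounded

theorem polNorm_le_ofReal {σ : ℝ} {F : ℂ × ℂ → ℂ} {B : ℝ} (h : ∀ p ∈ polDomain σ, ‖F p‖ ≤ B) :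
    polNorm σ F ≤ ENNReal.ofReal B :=
  iSup₂_le fun p hp => by
    rw [← ofReal_norm]
    exact ENNReal.ofReal_le_ofReal (h p hp)

namespace HasPol

variable {σ σ' B : ℝ} {f : ℂ → ℂ} {K : ℂ × ℂ → ℂ}

theorem conj_mem_holDomain {p : ℂ × ℂ} (hp : p ∈ polDomain σ) : (p.1, conj p.2) ∈ holDomain σ := by
  simpa [holDomain] using hp

theorem memHInf (hK : HasPol σ f K B) : MemHInf σ f := by
  refine ⟨fun p => K (p.1, conj p.2), ?_, ?_, hK.diag⟩
  · simp only [Complex.conj_conj]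
    exact hK.diff
  · exact (polNorm_le_ofReal fun p hp => hK.bound _ (conj_mem_holDomain hp)).trans_lt
      ENNReal.ofReal_lt_top

/-- `polarize` is a choice; uniqueness of polarizations identifies it on the domain with any
explicit `K`. -/
theorem polarize_eq (hK : HasPol σ f K B) (hσ : 0 < σ) {p : ℂ × ℂ} (hp : p ∈ polDomain σ) :
    polarize σ f p = K (p.1, conj p.2) := by
  have hs := hK.memHInf.hasPol.sub hK
  have := eq_zero_of_diag hσ hs.diff (by filter_upwards [hs.diag] with z hz; rw [hz, sub_self])
    (conj_mem_holDomain hp)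
  simpa using sub_eq_zero.1 this

theorem polNorm_polarize_le (hK : HasPol σ f K B) (hσ : 0 < σ) :
    polNorm σ (polarize σ f) ≤ ENNReal.ofReal B :=
  polNorm_le_ofReal fun p hp => by
    rw [hK.polarize_eq hσ hp]
    exact hK.bound _ (conj_mem_holDomain hp)

theorem polNorm_dbarW_polarize_le (hK : HasPol σ f K B) (h0 : 0 < σ') (hσ : σ' < σ) (h1 : σ ≤ 1) :
    polNorm σ' (dbarW (polarize σ' f)) ≤ ENNReal.ofReal (6 / (σ - σ') * B) := by
  refine polNorm_le_ofReal fun p hp => ?_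
  have hp' := conj_mem_holDomain hp
  have hKσ' := hK.mono h0.le hσ.le h1 le_rfl
  have hd := hKσ'.diff.differentiableAt ((isOpen_holDomain σ').mem_nhds hp')
  have hopen : ∀ᶠ w in 𝓝 p.2, (p.1, w) ∈ polDomain σ' :=
    ((isOpen_polDomain σ').preimage (Continuous.prodMk_right p.1)).mem_nhds hp
  have hev : (fun w => polarize σ' f (p.1, w)) =ᶠ[𝓝 p.2] fun w => K (p.1, conj w) := by
    filter_upwards [hopen] with w hw
    exact hKσ'.polarize_eq h0 hw
  have hslice := hasDerivAt_snd_slice hd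
  have e : dbarW (polarize σ' f) p = fderiv ℂ K (p.1, conj p.2) (0, 1) := by
    rw [← hslice.deriv, dbarW, ← dbar_comp_conj hslice.differentiableAt, SoftRH.dbar, SoftRH.dbar,
      hev.fderiv_eq]
  rw [e]
  exact norm_fderiv_snd_le h0.le hσ h1 hK.diff hK.bound hp'

end HasPol

/-! ### The operator `T` -/

theorem exists_hasPol_opT {R : ℂ → ℝ} {σ₀ : ℝ} (h0 : 0 < σ₀) (h1 : σ₀ ≤ 1)
    (hH : MemHInf σ₀ (coefH R)) (hM : MemHInf σ₀ (coefM R)) (hW : MemHInf σ₀ (coefW R)) :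
    ∃ C : ℝ, 0 < C ∧ ∀ (σ σ' : ℝ) (f : ℂ → ℂ) (K : ℂ × ℂ → ℂ) (B : ℝ), 0 < σ' → σ' < σ → σ ≤ σ₀ →
      HasPol σ f K B → ∃ K', HasPol σ' (opT R f) K' (C / (σ - σ') ^ 2 * B) := by
  have pH := hH.hasPol
  have pM := hM.hasPol
  have pW := hW.hasPol
  set a := (polNorm σ₀ (polarize σ₀ (coefH R))).toReal
  set b := (polNorm σ₀ (polarize σ₀ (coefM R))).toReal
  set c := (polNorm σ₀ (polarize σ₀ (coefW R))).toReal
  set κ : ℂ := ((Real.sqrt (2 * Real.pi))⁻¹ : ℂ)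
  have ha : 0 ≤ a := pH.nonneg h0
  have hb : 0 ≤ b := pM.nonneg h0
  have hc : 0 ≤ c := pW.nonneg h0
  -- Half of the gap `σ - σ'` is spent on `∂̄` and half on `M` or `P`: `840 = (35 · 2)(6 · 2)` and
  -- `720 = (30 · 2)(6 · 2)`. The `+ 1` only makes `C` positive.
  refine ⟨840 * a * b + 720 * ‖κ‖ * c * a + 1, by positivity, ?_⟩
  intro σ σ' f K B hσ' hσ hσ₀ hK
  have hσ1 : σ ≤ 1 := hσ₀.trans h1
  set τ := (σ + σ') / 2 with hτ
  have hτ0 : 0 < τ := by linarith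
  have hB := hK.nonneg (hσ'.trans hσ)
  have hg : HasPol τ (fun z => dbar f z / conj (HR R z)) _ (6 / (σ - τ) * B * a) :=
    ((hK.dbar hτ0 (by linarith) hσ1).mul (pH.mono hτ0.le (by linarith) h1 le_rfl) hτ0).congr
      (Eventually.of_forall fun z => by simp only [coefH, mul_one_div])
  have hgM := (pM.mono hσ'.le (by linarith) h1 le_rfl).mul
    (hg.opM hσ' (by linarith) (by linarith)) hσ'
  have hgW := ((pW.mono hσ'.le (by linarith) h1 le_rfl).const_mul κ).mul
    (hg.projMinus hσ' (by linarith) (by linarith)) hσ'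
  refine ⟨_, (hgM.sub hgW).mono hσ'.le le_rfl (by linarith) ?_⟩
  have hδ : 0 < σ - σ' := by linarith
  have e1 : σ - τ = (σ - σ') / 2 := by rw [hτ]; ring
  have e2 : τ - σ' = (σ - σ') / 2 := by rw [hτ]; ring
  rw [e1, e2]
  calc b * (35 / ((σ - σ') / 2) * (6 / ((σ - σ') / 2) * B * a)) +
        ‖κ‖ * c * (30 / ((σ - σ') / 2) * (6 / ((σ - σ') / 2) * B * a))
      = (840 * a * b + 720 * ‖κ‖ * c * a) / (σ - σ') ^ 2 * B := by
        field_simp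
        ring
    _ ≤ (840 * a * b + 720 * ‖κ‖ * c * a + 1) / (σ - σ') ^ 2 * B :=
        mul_le_mul_of_nonneg_right (div_le_div_of_nonneg_right (by linarith) (by positivity)) hB

theorem exists_hasPol_iterate {T : (ℂ → ℂ) → ℂ → ℂ} {σ₀ C : ℝ}
    (hT : ∀ (σ σ' : ℝ) (f : ℂ → ℂ) (K : ℂ × ℂ → ℂ) (B : ℝ), 0 < σ' → σ' < σ → σ ≤ σ₀ →
      HasPol σ f K B → ∃ K', HasPol σ' (T f) K' (C / (σ - σ') ^ 2 * B))
    {f : ℂ → ℂ} {K : ℂ × ℂ → ℂ} {B : ℝ} (hK : HasPol σ₀ f K B) {δ : ℝ} (hδ : 0 < δ) (n : ℕ)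
    (hn : n * δ < σ₀) : ∃ K', HasPol (σ₀ - n * δ) (T^[n] f) K' ((C / δ ^ 2) ^ n * B) := by
  induction n with
  | zero => exact ⟨K, by simpa using hK⟩
  | succ n ih =>
    push_cast at hn ⊢
    obtain ⟨K', hK'⟩ := ih (by linarith)
    have hle : 0 ≤ (n : ℝ) * δ := by positivity
    obtain ⟨K'', hK''⟩ := hT (σ₀ - n * δ) (σ₀ - (n + 1) * δ) _ _ _ (by linarith) (by linarith)
      (by linarith) hK'
    refine ⟨K'', ?_⟩
    have e : σ₀ - n * δ - (σ₀ - (n + 1) * δ) = δ := by ring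
    rw [e, ← mul_assoc, ← pow_succ'] at hK''
    rwa [Function.iterate_succ_apply']

theorem ofReal_pow_mul (M : ℝ≥0) (k j n : ℕ) {B : ℝ≥0∞} (hB : B ≠ ∞) :
    ENNReal.ofReal ((M : ℝ) ^ k * (n : ℝ) ^ j * B.toReal) =
      (M : ℝ≥0∞) ^ k * (n : ℝ≥0∞) ^ j * B := by
  rw [ENNReal.ofReal_mul (by positivity), ENNReal.ofReal_mul (by positivity),
    ENNReal.ofReal_pow M.coe_nonneg, ENNReal.ofReal_pow n.cast_nonneg, ENNReal.ofReal_coe_nnreal,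
    ENNReal.ofReal_natCast, ENNReal.ofReal_toReal hB]

end SoftRH

end

/-! ### Choice of the step length and of the constant `M₁`. -/

theorem theorem5p1 (R : ℂ → ℝ)
    (hR_analytic : AnalyticOnNhd ℝ R SoftRH.unitCircle)
    (hR_zero : ∀ z ∈ SoftRH.unitCircle, R z = 0)
    (hR_grad : ∀ z ∈ SoftRH.unitCircle, fderiv ℝ R z = 0)
    (hR_lap : ∀ z ∈ SoftRH.unitCircle, 0 < SoftRH.quarterLaplacian R z)
    (σ₀ : ℝ) (hσ_pos : 0 < σ₀) (hσ_lt : σ₀ < 1)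
    (hσ_H : SoftRH.MemHInf σ₀ (SoftRH.coefH R))
    (hσ_M : SoftRH.MemHInf σ₀ (SoftRH.coefM R))
    (hσ_W : SoftRH.MemHInf σ₀ (SoftRH.coefW R)) :
    ∃ M₁ : ℝ≥0, 0 < M₁ ∧ ∀ f : ℂ → ℂ, SoftRH.MemHInf σ₀ f →
      (∀ k : ℕ, SoftRH.MemHInf (σ₀ / 2) ((SoftRH.opT R)^[k] f) ∧
        SoftRH.polNorm (σ₀ / 2) (SoftRH.polarize (σ₀ / 2) ((SoftRH.opT R)^[k] f)) ≤
          (M₁ : ℝ≥0∞) ^ k * (k : ℝ≥0∞) ^ (2 * k) *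
            SoftRH.polNorm σ₀ (SoftRH.polarize σ₀ f)) ∧
      (∀ k : ℕ, 2 ≤ k →
        SoftRH.polNorm (σ₀ / 2)
            (SoftRH.dbarW (SoftRH.polarize (σ₀ / 2) ((SoftRH.opT R)^[k - 1] f))) ≤
          6 * (M₁ : ℝ≥0∞) ^ (k - 1) * (k : ℝ≥0∞) ^ (2 * k - 1) *
            SoftRH.polNorm σ₀ (SoftRH.polarize σ₀ f)) ∧
      SoftRH.polNorm (σ₀ / 2) (SoftRH.dbarW (SoftRH.polarize (σ₀ / 2) f)) ≤
        ENNReal.ofReal (12 / σ₀) * SoftRH.polNorm σ₀ (SoftRH.polarize σ₀ f) := by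
  obtain ⟨C, hC, hT⟩ := SoftRH.exists_hasPol_opT hσ_pos hσ_lt.le hσ_H hσ_M hσ_W
  -- Iterating `T` alone needs only `4 C / σ₀²`. The extra factor `2 / σ₀ ≥ 1` is there to absorb
  -- the cost of the final derivative in the second estimate.
  have hM0 : 0 < 8 * C / σ₀ ^ 3 := by positivity
  have hσ2 : 0 < σ₀ / 2 := by linarith
  obtain ⟨M, hM⟩ : ∃ M : ℝ≥0, (M : ℝ) = 8 * C / σ₀ ^ 3 :=
    ⟨Real.toNNReal _, Real.coe_toNNReal _ hM0.le⟩
  refine ⟨M, by rw [← NNReal.coe_pos, hM]; exact hM0, fun f hf => ?_⟩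
  have hK := hf.hasPol
  have hN := hf.polNorm_lt_top.ne
  set N := SoftRH.polNorm σ₀ (SoftRH.polarize σ₀ f)
  have hMr : (M : ℝ) = 2 / σ₀ * (4 * C / σ₀ ^ 2) := by
    rw [hM]
    field_simp
    ring
  have hone : 1 ≤ 2 / σ₀ := by rw [one_le_div hσ_pos]; linarith
  have hD : 0 ≤ 4 * C / σ₀ ^ 2 := by positivity
  have hN0 : 0 ≤ N.toReal := ENNReal.toReal_nonneg
  have hstep : ∀ k : ℕ, k ≠ 0 → ∀ n : ℕ,
      (C / (σ₀ / (2 * k)) ^ 2) ^ n = (4 * C / σ₀ ^ 2) ^ n * (k : ℝ) ^ (2 * n) := by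
    intro k hk n
    have : (k : ℝ) ≠ 0 := by exact_mod_cast hk
    rw [pow_mul, ← mul_pow]
    congr 1
    field_simp
    ring
  refine ⟨fun k => ?_, fun k hk => ?_, ?_⟩
  · rcases Nat.eq_zero_or_pos k with rfl | hk
    · have h := hK.mono hσ2.le (by linarith) hσ_lt.le le_rfl
      refine ⟨h.memHInf, (h.polNorm_polarize_le hσ2).trans_eq ?_⟩
      rw [ENNReal.ofReal_toReal hN]
      simp
    · have hk0 : (0 : ℝ) < k := by exact_mod_cast hk
      have e : (k : ℝ) * (σ₀ / (2 * k)) = σ₀ / 2 := by field_simp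
      obtain ⟨K', hK'⟩ := SoftRH.exists_hasPol_iterate hT hK (δ := σ₀ / (2 * k)) (by positivity) k
        (by rw [e]; linarith)
      rw [e, sub_half, hstep k hk.ne'] at hK'
      refine ⟨hK'.memHInf, (hK'.polNorm_polarize_le hσ2).trans ?_⟩
      rw [← SoftRH.ofReal_pow_mul M _ _ _ hN]
      refine ENNReal.ofReal_le_ofReal ?_
      have : 4 * C / σ₀ ^ 2 ≤ M := by rw [hMr]; exact le_mul_of_one_le_left hD hone
      gcongr
  · obtain ⟨n, rfl⟩ : ∃ n, k = n + 1 := ⟨k - 1, by omega⟩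
    have hn : n ≠ 0 := by omega
    have hk0 : (0 : ℝ) < ((n + 1 : ℕ) : ℝ) := by positivity
    set k : ℝ := ((n + 1 : ℕ) : ℝ) with hk_def
    have hnk : (n : ℝ) = k - 1 := by rw [hk_def]; push_cast; ring
    -- The interval is cut into `k = n + 1` steps: `n` for the applications of `T`, and the last for
    -- the derivative, whose cost `6 / δ = 6 · (2 / σ₀) · k` raises the exponent of `k` to `2n + 1 =
    -- 2k - 1`.
    set δ := σ₀ / (2 * k) with hδ_def
    have hδ : 0 < δ := by positivity
    have e : k * δ = σ₀ / 2 := by rw [hδ_def]; field_simp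
    have e' : (n : ℝ) * δ = σ₀ / 2 - δ := by rw [hnk, sub_mul, e, one_mul]
    obtain ⟨K', hK'⟩ := SoftRH.exists_hasPol_iterate hT hK hδ n (by rw [e']; linarith)
    rw [e', hstep (n + 1) n.succ_ne_zero] at hK'
    have h := hK'.polNorm_dbarW_polarize_le hσ2 (by linarith) (by linarith [mul_nonneg n.cast_nonneg hδ.le])
    have e2 : 2 * (n + 1) - 1 = 2 * n + 1 := by omega
    rw [Nat.add_sub_cancel, e2, mul_assoc 6, mul_assoc 6, ← SoftRH.ofReal_pow_mul M _ _ _ hN]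
    refine h.trans ?_
    have h6 : (6 : ℝ≥0∞) = ENNReal.ofReal 6 := by norm_num
    rw [h6, ← ENNReal.ofReal_mul (by norm_num)]
    refine ENNReal.ofReal_le_ofReal ?_
    have e3 : σ₀ - (σ₀ / 2 - δ) - σ₀ / 2 = δ := by ring
    -- A single factor `2 / σ₀` has to be absorbed and `M ^ n` contains `n ≥ 1` of them. For `k = 1`
    -- none is available, so that case keeps its own constant `12 / σ₀ = 6 / (σ₀ / 2)`.
    have hpow : 2 / σ₀ * (4 * C / σ₀ ^ 2) ^ n ≤ (M : ℝ) ^ n := by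
      rw [hMr, mul_pow]
      exact mul_le_mul_of_nonneg_right (le_self_pow₀ hone hn) (pow_nonneg hD n)
    rw [e3]
    calc 6 / δ * ((4 * C / σ₀ ^ 2) ^ n * k ^ (2 * n) * N.toReal)
        = 6 * (2 / σ₀ * (4 * C / σ₀ ^ 2) ^ n * k ^ (2 * n + 1) * N.toReal) := by
          rw [hδ_def, pow_succ k]
          field_simp
      _ ≤ 6 * ((M : ℝ) ^ n * k ^ (2 * n + 1) * N.toReal) := by gcongr
  · refine (hK.polNorm_dbarW_polarize_le hσ2 (by linarith) hσ_lt.le).trans_eq ?_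
    rw [ENNReal.ofReal_mul (by rw [sub_half]; positivity), ENNReal.ofReal_toReal hN, sub_half]
    congr 2
    field_simp
    norm_num
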